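/- **Setting.** Let $p,q,n$ be natural numbers, $\beta>0$, $M>1$, $\delta\in\mathbb R$ and $\sigma:[0,2\pi]\to\mathbb R$. A linear dynamical system (LDS) on the nodes $V=\{1,\dots,p\}$ is $$x_i(k)=\sum_{j}(h_{ij}\star x_j)(k)+e_i(k),\qquad k\in\mathbb Z,\ 1\le i\le p,$$ with real $\ell^1$ impulse responses $h_{ij}$, such that the directed graph $G$ with an edge $j\to i$ iff $h_{ij}\neq0$ is acyclic ($G$ is the DDAG of the system), and where $e_1,\dots,e_p$ are zero-mean stationary Gaussian processes, uncorrelated across nodes, with a common absolutely summable autocovariance $r$. Write $\mathbf H(\omega)=\sum_k h(k)e^{-i\omega k}$ for the transfer matrix, $\Phi_{\mathbf e}(\omega)=\big(\sum_k r(k)e^{-i\omega k}\big)I$ and $\Phi_{\mathbf x}(\omega)=(I-\mathbf H(\omega))^{-1}\Phi_{\mathbf e}(\omega)\big((I-\mathbf H(\omega))^{-1}\big)^*$ for the power spectral density matrices of $e$ and $x$. Let $\mathcal H_{p,q}(\beta,\sigma,M)$ be the family of all such systems $H$ whose DDAG $G(H)$ has at most $q$ parents per node and for which, for all $\omega\in[0,2\pi]$: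 $|\mathbf H_{ij}(\omega)|\ge\beta$ for every edge $j\to i$, $\Phi_{\mathbf e}(\omega)=\sigma(\omega)I$, and $M^{-1}\le\lambda_{\min}(\Phi_{\mathbf x}(\omega))\le\lambda_{\max}(\Phi_{\mathbf x}(\omega))\le M$. **Samples.** Fix a frequency $\omega\in[0,2\pi]$. The data are $n$ samples $\mathbf x^1(\omega),\dots,\mathbf x^n(\omega)\in\mathbb C^p$ of one of the following kinds: (i) i.i.d. circularly symmetric complex Gaussian vectors $N(0,\Phi_{\mathbf x}(\omega))$; (ii) for some $N$, $\mathbf x^r(\omega)=N^{-1/2}\sum_{k=0}^{N-1}x^r(k)e^{-i\omega k}$ for $n$ independent trajectories $x^r$ of length $N$ of the stationary process $x$ (restart and record); (iii) the same with $x^1,\dots,x^n$ the $n$ consecutive segments of length $N$ of a single trajectory of length $nN$ (continuous sampling). **Theorem.** Suppose that $1\le q\le p/2$, that the parameter $q$ is attained in the family (some system in $\mathcal H_{p,q}(\beta,\sigma,M)$ has a node with exactly $q$ parents), and that $$n\le(1-2\delta)\max\left(\frac{\log p}{2\beta^2+\beta^4},\ \frac{q\log(p/q)}{M^2-1}\right).$$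 Then for each of the sampling schemes (i)–(iii), every measurable estimator $\widehat G$ of the DDAG from the samples $\mathbf x^1(\omega),\dots,\mathbf x^n(\omega)$ satisfies $$\max_{H\in\mathcal H_{p,q}(\beta,\sigma,M)}\mathbb P\{G(H)\neq\widehat G\}\ \ge\ \delta ,$$ in the sense that some $H\in\mathcal H_{p,q}(\beta,\sigma,M)$ has $\mathbb P\{G(H)\neq\widehat G\}\ge\delta$; in particular $\inf_{\widehat G}\sup_{H}\mathbb P\{G(H)\neq\widehat G\}\ge\delta$. -/

import Mathlib

open MeasureTheory ProbabilityTheory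

noncomputable section

namespace DDAG

/-- Discrete-time Fourier transform `∑ₖ a(k) e^{-iωk}` of a real two-sided sequence. -/
def dtft (a : ℤ → ℝ) (ω : ℝ) : ℂ :=
  ∑' k : ℤ, (a k : ℂ) * Complex.exp (-(Complex.I * ω * k))

/-- A digraph is acyclic if there is no directed path (of length at least one) from a node
to itself. -/
def IsAcyclic {V : Type*} (G : Digraph V) : Prop :=
  ∀ i, ¬ Relation.TransGen G.Adj i i

/-- `pa(i)`: the set of parents of the node `i`. -/
def parents {V : Type*} (G : Digraph V) (i : V) : Set V :=
  {j | G.Adj j i}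

/-- The DAGs on `p` nodes with at most `q` parents per node. -/
def dagFamily (p q : ℕ) : Set (Digraph (Fin p)) :=
  {G | IsAcyclic G ∧ ∀ i, (parents G i).ncard ≤ q}

/-- The directed graph of a matrix of impulse responses: `j → i` is an edge iff `h i j ≠ 0`. -/
def filterGraph {p : ℕ} (h : Fin p → Fin p → ℤ → ℝ) : Digraph (Fin p) where
  Adj j i := h i j ≠ 0

/-- A linear dynamical system over a DAG,
`x_i(k) = ∑_j (h_{ij} ⋆ x_j)(k) + e_i(k)`, `k ∈ ℤ`,
with `ℓ¹` impulse responses `h i j`. The noises `e_i` are zero-mean stationary Gaussian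
processes, uncorrelated across nodes, with common autocovariance
`r k = E[e_i(k) e_i(0)]`, a symmetric, positive semidefinite, summable sequence. -/
structure LDS (p : ℕ) where
  h : Fin p → Fin p → ℤ → ℝ
  h_summable : ∀ i j, Summable (h i j)
  acyclic : IsAcyclic (filterGraph h)
  r : ℤ → ℝ
  r_summable : Summable r
  r_symm : ∀ k, r (-k) = r k
  r_posSemidef : ∀ (s : Finset ℤ) (c : ℤ → ℝ),
    0 ≤ ∑ a ∈ s, ∑ b ∈ s, c a * c b * r (a - b)

namespace LDS

variable {p : ℕ} (S : LDS p)

/-- The DDAG `G(H)` of the system. -/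
def graph : Digraph (Fin p) := filterGraph S.h

/-- The transfer matrix `H(ω)`. -/
def transfer (ω : ℝ) : Matrix (Fin p) (Fin p) ℂ :=
  Matrix.of fun i j => dtft (S.h i j) ω

/-- The power spectral density of each noise, so that `Φ_e(ω) = noisePsd ω • I`. -/
def noisePsd (ω : ℝ) : ℂ := dtft S.r ω

/-- The power spectral density matrix of the states,
`Φ_x(ω) = (I - H(ω))⁻¹ Φ_e(ω) ((I - H(ω))⁻¹)^*`. -/
def psdm (ω : ℝ) : Matrix (Fin p) (Fin p) ℂ :=
  (1 - S.transfer ω)⁻¹ * (S.noisePsd ω • (1 : Matrix (Fin p) (Fin p) ℂ)) *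
    ((1 - S.transfer ω)⁻¹).conjTranspose

lemma star_noisePsd (ω : ℝ) : star (S.noisePsd ω) = S.noisePsd ω := by
  unfold noisePsd dtft
  rw [tsum_star, ← (Equiv.neg ℤ).tsum_eq]
  refine tsum_congr fun k => ?_
  simp only [Equiv.neg_apply, S.r_symm, RCLike.star_def, map_mul, ← Complex.exp_conj,
    Complex.conj_ofReal, map_neg, Complex.conj_I]
  simp

lemma psdm_isHermitian (ω : ℝ) : (S.psdm ω).IsHermitian := by
  unfold psdm Matrix.IsHermitian
  rw [Matrix.conjTranspose_mul, Matrix.conjTranspose_mul, Matrix.conjTranspose_conjTranspose,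
    Matrix.conjTranspose_smul, Matrix.conjTranspose_one, star_noisePsd, Matrix.mul_assoc]

/-- The autocorrelation `R_x(k) = E[x(k) x(0)ᵀ]` of the states: the inverse DTFT of `Φ_x`
(which is real since the impulse responses and `r` are real). -/
def autocorr (k : ℤ) : Matrix (Fin p) (Fin p) ℝ :=
  Matrix.of fun i j =>
    ((1 / (2 * Real.pi) : ℂ) *
      ∫ ω in (0 : ℝ)..(2 * Real.pi), S.psdm ω i j * Complex.exp (Complex.I * ω * k)).re

/-- The law of `L` consecutive states `x(0), …, x(L-1)`: centered Gaussian with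
`E[x_i(s) x_j(t)] = R_x(s - t)_{ij}`. -/
def windowLaw (L : ℕ) : Measure (Fin L → Fin p → ℝ) :=
  (multivariateGaussian (0 : EuclideanSpace ℝ (Fin L × Fin p))
    (Matrix.of fun a b : Fin L × Fin p => S.autocorr ((a.1 : ℤ) - (b.1 : ℤ)) a.2 b.2)).map
    fun x t i => x (t, i)

end LDS

/-- The family `H_{p,q}(β,σ,M)`. -/
def family (p q : ℕ) (β : ℝ) (σ : ℝ → ℝ) (M : ℝ) : Set (LDS p) :=
  {S | S.graph ∈ dagFamily p q ∧
    ∀ ω ∈ Set.Icc 0 (2 * Real.pi),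
      (∀ i j, S.graph.Adj j i → β ≤ ‖S.transfer ω i j‖) ∧
      S.noisePsd ω = (σ ω : ℂ) ∧
      ∀ i, M⁻¹ ≤ (S.psdm_isHermitian ω).eigenvalues i ∧
        (S.psdm_isHermitian ω).eigenvalues i ≤ M}

/-- The normalized finite Fourier transform `N^{-1/2} ∑_{k<N} y(k) e^{-iωk}` of a segment of
`N` states. -/
def segmentDFT {p N : ℕ} (ω : ℝ) (y : Fin N → Fin p → ℝ) : Fin p → ℂ := fun i =>
  (1 / Real.sqrt N : ℂ) * ∑ k : Fin N, (y k i : ℂ) * Complex.exp (-(Complex.I * ω * (k : ℕ)))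

/-- The circularly symmetric complex Gaussian distribution with mean `0` and variance `v`. -/
def complexGaussian (v : NNReal) : Measure ℂ :=
  ((gaussianReal 0 (v / 2)).prod (gaussianReal 0 (v / 2))).map
    fun z => (z.1 : ℂ) + (z.2 : ℂ) * Complex.I

/-- How the `n` samples at a given frequency are obtained. -/
inductive Sampling where
  /-- Independent draws of `x(ω) ∼ N(0, Φ_x(ω))`. -/
  | spectral : Sampling
  /-- Finite Fourier transforms of `n` independent trajectories of length `N`. -/
  | restartRecord (N : ℕ) : Sampling
  /-- Finite Fourier transforms of the `n` consecutive segments of length `N` of one trajectory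
  of length `n * N`. -/
  | continuous (N : ℕ) : Sampling

/-- The law of the complex Gaussian vector `x(ω)` that solves `x(ω) = H(ω) x(ω) + e(ω)` with
`e(ω) ∼ N(0, Φ_e(ω))`. -/
def LDS.spectralLaw {p : ℕ} (S : LDS p) (ω : ℝ) : Measure (Fin p → ℂ) :=
  (Measure.pi fun _ : Fin p => complexGaussian (S.noisePsd ω).re.toNNReal).map
    fun e => ((1 - S.transfer ω)⁻¹).mulVec e

/-- The joint law of the samples `x¹(ω), …, xⁿ(ω)`. -/
def LDS.sampleLaw {p : ℕ} (S : LDS p) (n : ℕ) (ω : ℝ) : Sampling → Measure (Fin n → Fin p → ℂ)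
  | .spectral => Measure.pi fun _ : Fin n => S.spectralLaw ω
  | .restartRecord N =>
      (Measure.pi fun _ : Fin n => S.windowLaw N).map fun y a => segmentDFT ω (y a)
  | .continuous N =>
      (S.windowLaw (n * N)).map fun y a =>
        segmentDFT ω fun k : Fin N => y (finProdFinEquiv (a, k))

/-- A (measurable) estimator of the DDAG from `n` samples. -/
def IsEstimator {n p : ℕ} (Ghat : (Fin n → Fin p → ℂ) → Digraph (Fin p)) : Prop :=
  ∀ G, MeasurableSet (Ghat ⁻¹' {G})

end DDAG

end

noncomputable section

namespace DDAG

/-! The hard instances are memoryless systems `x_i = β x_{f i} + e_i` for `i` in a set `T` of `m`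
nodes, where `f` matches `T` into its complement, all driven by the noise of the system that attains
`q`. Here `(I - H)⁻¹` is `A = 1 + N` with `N² = 0`, so `|det A| = 1`, and the squared Frobenius norm
of `A` is `p + mβ²`.

Since `A` is real and independent of the frequency, under every sampling scheme the data are one
common Gaussian array with values in `ℂⁿ` in each of `p` independent columns, mixed by `A`
(`exists_sampleLaw_eq_mixedLaw`). However correlated the samples are, a column lives in a real space
of dimension `2n` and is built from `2n` standard normals. The divergence from pure noise is
therefore at most `2n · mβ² / 2 = nmβ²` (`mul_mixedLaw_le`), whatever the segment length.

The graph determines `T`, so there are `p.choose m` alternatives to the empty graph, and a Fano-type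
argument applies (`not_all_errors_lt`). The empty graph belongs to the family as well, so its own
error already bounds by `δ` the total null probability of declaring some alternative. This yields
the threshold `(1 - 2δ) log (p.choose m)` with no additive `log 2`. Taking `m = 1` and `m = q` in
`exists_error_ge_of_matchings` gives the two terms of the maximum.

It remains to see that the instances lie in the family. Their spectral densities have eigenvalues
between `σ / s²` and `σ s²`, where `s` is the top singular value of a shear of gain `β`. Any member
of the family with an edge forces `σ s² ≤ M` and `s² ≤ M σ` (`family_edge_bounds`). A node with `q`
parents forces `1 + qβ² ≤ M σ` (`family_parents_bound`), which with `σ ≤ M` turns `qβ²` into `M² -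
1`. -/

/-- The law of `∑ k, z k • v k` for independent standard Gaussian variables `z k`. -/
def gaussianSum {κ E : Type*} [Fintype κ] [AddCommGroup E] [Module ℝ E] [MeasurableSpace E]
    (v : κ → E) : Measure E :=
  (Measure.pi fun _ : κ => gaussianReal 0 1).map fun z => ∑ k, z k • v k

/-! ### Gaussian laws as linear images of white noise -/

section GaussianSum

variable {κ κ' E : Type*} [Fintype κ] [Fintype κ'] [NormedAddCommGroup E] [NormedSpace ℝ E]
  [MeasurableSpace E] [BorelSpace E] [SecondCountableTopology E]

lemma measurable_sum_smul (v : κ → E) : Measurable fun z : κ → ℝ => ∑ k, z k • v k := by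
  fun_prop

instance (v : κ → E) : IsProbabilityMeasure (gaussianSum v) :=
  Measure.isProbabilityMeasure_map (measurable_sum_smul v).aemeasurable

lemma charFunDual_gaussianSum (v : κ → E) (L : StrongDual ℝ E) :
    charFunDual (gaussianSum v) L = Complex.exp (-((∑ k, L (v k) ^ 2 : ℝ) : ℂ) / 2) := by
  rw [charFunDual_apply, gaussianSum, integral_map (measurable_sum_smul v).aemeasurable
    (Measurable.aestronglyMeasurable (by fun_prop))]
  simp_rw [map_sum, map_smul, Complex.ofReal_sum, Finset.sum_mul, Complex.exp_sum]
  rw [integral_fintype_prod_eq_prod (f := fun k x => Complex.exp ((x • L (v k) : ℝ) * Complex.I))]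
  simp_rw [smul_eq_mul, mul_comm _ (L (v _)), Complex.ofReal_mul, ← charFun_apply_real,
    charFun_gaussianReal]
  rw [← Complex.exp_sum]
  congr 1
  simp [Finset.sum_div, neg_div]

/-- A centered Gaussian law depends only on its covariance form `L ↦ ∑ L (v k) ^ 2`, so generating
vectors may be replaced freely as long as this form is kept. -/
lemma gaussianSum_congr [CompleteSpace E] {v : κ → E} {w : κ' → E}
    (h : ∀ L : StrongDual ℝ E, ∑ k, L (v k) ^ 2 = ∑ k, L (w k) ^ 2) :
    gaussianSum v = gaussianSum w := by
  refine Measure.ext_of_charFunDual (funext fun L => ?_)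
  rw [charFunDual_gaussianSum, charFunDual_gaussianSum, h]

lemma gaussianSum_map {F : Type*} [NormedAddCommGroup F] [NormedSpace ℝ F] [MeasurableSpace F]
    [BorelSpace F] (v : κ → E) (Φ : E →L[ℝ] F) :
    (gaussianSum v).map Φ = gaussianSum fun k => Φ (v k) := by
  rw [gaussianSum, gaussianSum, Measure.map_map (by fun_prop) (by fun_prop)]
  congr 1
  ext z
  simp

lemma pi_gaussianSum {ι : Type*} [Fintype ι] [DecidableEq ι] [CompleteSpace E] (v : κ → E) :
    Measure.pi (fun _ : ι => gaussianSum v) =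
      gaussianSum fun a : ι × κ => (Pi.single a.1 (v a.2) : ι → E) := by
  refine Measure.ext_of_charFunDual (funext fun L => ?_)
  rw [charFunDual_pi, charFunDual_gaussianSum]
  simp_rw [charFunDual_gaussianSum]
  rw [← Complex.exp_sum, Fintype.sum_prod_type]
  simp [Finset.sum_div, neg_div]

lemma sum_sq_transpose_mulVec {ι κ : Type*} [Fintype ι] [Fintype κ] (D : Matrix ι κ ℝ)
    (y : ι → ℝ) : ∑ k, (∑ i, D i k * y i) ^ 2 = y ⬝ᵥ (D * D.transpose).mulVec y := by
  rw [← Matrix.mulVec_mulVec, Matrix.dotProduct_mulVec, ← Matrix.mulVec_transpose]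
  simp [dotProduct, Matrix.mulVec, sq]

open scoped MatrixOrder in
lemma exists_eq_mul_transpose {ι : Type*} [Fintype ι] [DecidableEq ι] {S : Matrix ι ι ℝ}
    (hS : S.PosSemidef) : ∃ C : Matrix ι ι ℝ, S = C * C.transpose := by
  obtain ⟨C, hC⟩ := CStarAlgebra.nonneg_iff_eq_star_mul_self.1 hS.nonneg
  exact ⟨C.transpose, by simpa [Matrix.star_eq_conjTranspose] using hC⟩

end GaussianSum

/-- A Gaussian sum in an `ι`-dimensional space is a Gaussian sum of `ι`-many vectors. -/
lemma exists_gram_eq {ι κ E : Type*} [Fintype ι] [Fintype κ]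
    [AddCommGroup E] [Module ℝ E] (b : Module.Basis ι ℝ E) (d : κ → E) :
    ∃ c : ι → E, ∀ l : E →ₗ[ℝ] ℝ, ∑ k, l (d k) ^ 2 = ∑ i, l (c i) ^ 2 := by
  classical
  let D : Matrix ι κ ℝ := Matrix.of fun i k => b.repr (d k) i
  have hS : (D * D.transpose).PosSemidef := by
    simpa using Matrix.posSemidef_self_mul_conjTranspose D
  -- A square factor of the covariance in coordinates: its columns are the new generators, as many
  -- as the dimension, however large `κ` was.
  obtain ⟨C, hC⟩ := exists_eq_mul_transpose hS
  refine ⟨fun j => ∑ i, C i j • b i, fun l => ?_⟩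
  have h1 : ∀ k, l (d k) = ∑ i, D i k * l (b i) := fun k => by
    conv_lhs => rw [← b.sum_repr (d k)]
    simp only [map_sum, map_smul, smul_eq_mul, D, Matrix.of_apply]
  simp_rw [h1, map_sum, map_smul, smul_eq_mul]
  rw [sum_sq_transpose_mulVec, sum_sq_transpose_mulVec, hC]

lemma multivariateGaussian_eq_gaussianSum {ι κ : Type*} [Fintype ι] [DecidableEq ι] [Fintype κ]
    (B : Matrix ι κ ℝ) :
    multivariateGaussian (0 : EuclideanSpace ℝ ι) (B * B.transpose) =
      gaussianSum fun k => (WithLp.toLp 2 fun i => B i k : EuclideanSpace ℝ ι) := by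
  have hS : (B * B.transpose).PosSemidef := by
    simpa using Matrix.posSemidef_self_mul_conjTranspose B
  refine Measure.ext_of_charFun (funext fun x => ?_)
  rw [charFun_multivariateGaussian hS, charFun_eq_charFunDual_toDualMap,
    charFunDual_gaussianSum]
  congr 1
  rw [← Matrix.mulVec_mulVec, Matrix.dotProduct_mulVec, ← Matrix.mulVec_transpose]
  simp [dotProduct, Matrix.mulVec, sq, PiLp.inner_apply, neg_div]

lemma gaussianReal_eq_gaussianSum (v : NNReal) :
    gaussianReal 0 v = gaussianSum fun _ : Unit => √v := by
  refine Measure.ext_of_charFun (funext fun x => ?_)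
  rw [charFun_gaussianReal, charFun_eq_charFunDual_toDualMap, charFunDual_gaussianSum]
  congr 1
  simp [mul_pow, ← Complex.ofReal_pow, Real.sq_sqrt]
  ring

lemma complexGaussian_eq_gaussianSum (v : NNReal) :
    complexGaussian v =
      gaussianSum fun b : Bool => ((√(v / 2) : ℝ) : ℂ) * (bif b then Complex.I else 1) := by
  have hL : complexGaussian v = ((gaussianReal 0 (v / 2)).prod (gaussianReal 0 (v / 2))).map
      (Complex.equivRealProdCLM.symm : ℝ × ℝ →L[ℝ] ℂ) := by
    unfold complexGaussian
    congr 1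
    ext z
    exact (Complex.equivRealProdCLM_symm_apply z).symm
  have : IsProbabilityMeasure (complexGaussian v) := by
    rw [hL]; exact Measure.isProbabilityMeasure_map (by fun_prop)
  refine Measure.ext_of_charFunDual (funext fun L => ?_)
  rw [charFunDual_gaussianSum, hL, charFunDual_map, charFunDual_prod,
    gaussianReal_eq_gaussianSum, charFunDual_gaussianSum, charFunDual_gaussianSum, ← Complex.exp_add]
  congr 1
  have h1 : L (((√(v / 2) : ℝ) : ℂ) * Complex.I) =
      L (Complex.equivRealProdCLM.symm (0, √(v / 2))) := by
    congr 1; simp [Complex.equivRealProdCLM_symm_apply]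
  have h2 : L ((√(v / 2) : ℝ) : ℂ) = L (Complex.equivRealProdCLM.symm (√(v / 2), 0)) := by
    simp [Complex.equivRealProdCLM_symm_apply]
  rw [Fintype.sum_bool]
  simp only [cond_true, cond_false, mul_one]
  rw [h1, h2]
  simp
  ring

/-! ### Change of measure between white noise and its unimodular images -/

section ChangeOfVariables

variable {ι : Type*} [Fintype ι]

lemma pi_gaussianReal_eq_withDensity :
    Measure.pi (fun _ : ι => gaussianReal 0 1) =
      (volume : Measure (ι → ℝ)).withDensity
        fun x => ENNReal.ofReal (∏ i, gaussianPDFReal 0 1 (x i)) := by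
  refine Measure.pi_eq fun s hs => ?_
  have hind : ∀ x : ι → ℝ, (Set.univ.pi s).indicator
      (fun x => ∏ i, gaussianPDFReal 0 1 (x i)) x =
        ∏ i, (s i).indicator (gaussianPDFReal 0 1) (x i) := by
    intro x
    by_cases hx : x ∈ Set.univ.pi s
    · rw [Set.indicator_of_mem hx]
      exact Finset.prod_congr rfl fun i _ => by rw [Set.indicator_of_mem (hx i trivial)]
    · rw [Set.indicator_of_notMem hx]
      simp only [Set.mem_univ_pi, not_forall] at hx
      obtain ⟨i, hi⟩ := hx
      rw [Finset.prod_eq_zero (Finset.mem_univ i)]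
      rw [Set.indicator_of_notMem hi]
  have hgint : Integrable (fun x : ι → ℝ => ∏ i, gaussianPDFReal 0 1 (x i)) :=
    Integrable.fintype_prod fun _ => integrable_gaussianPDFReal 0 1
  have hS : MeasurableSet (Set.univ.pi s) := MeasurableSet.univ_pi hs
  rw [withDensity_apply _ hS, ← ofReal_integral_eq_lintegral_ofReal hgint.integrableOn
    (ae_of_all _ fun x => Finset.prod_nonneg fun i _ => gaussianPDFReal_nonneg _ _ _),
    ← integral_indicator hS]
  simp_rw [hind]
  rw [integral_fintype_prod_volume_eq_prod, ENNReal.ofReal_prod_of_nonneg]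
  · refine Finset.prod_congr rfl fun i _ => ?_
    rw [gaussianReal_apply_eq_integral _ one_ne_zero, integral_indicator (hs i)]
  · exact fun i _ => integral_nonneg fun x =>
      Set.indicator_nonneg (fun x _ => gaussianPDFReal_nonneg _ _ _) _

lemma prod_gaussianPDFReal (x : ι → ℝ) :
    ∏ i, gaussianPDFReal 0 1 (x i) =
      (∏ _i : ι, (√(2 * Real.pi))⁻¹) * Real.exp (-(∑ i, x i ^ 2) / 2) := by
  simp only [gaussianPDFReal, NNReal.coe_one, mul_one, sub_zero]
  rw [Finset.prod_mul_distrib, ← Real.exp_sum, ← Finset.sum_div, Finset.sum_neg_distrib]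

/-- Change of variables for the standard Gaussian measure under a unimodular linear map. -/
lemma lintegral_comp_mulVec_pi_gaussianReal [DecidableEq ι] {A : Matrix ι ι ℝ} (hA : |A.det| = 1)
    {F : (ι → ℝ) → ENNReal} (hF : Measurable F) :
    ∫⁻ z, F (A.mulVec z) * ENNReal.ofReal
        (Real.exp ((∑ i, z i ^ 2) / 2 - (∑ i, A.mulVec z i ^ 2) / 2))
        ∂Measure.pi (fun _ : ι => gaussianReal 0 1) =
      ∫⁻ z, F z ∂Measure.pi (fun _ : ι => gaussianReal 0 1) := by
  have hmeas : Measurable fun x : ι → ℝ => ENNReal.ofReal (∏ i, gaussianPDFReal 0 1 (x i)) := by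
    have := measurable_gaussianPDFReal 0 1
    fun_prop
  have hAm : Measurable fun z : ι → ℝ => A.mulVec z :=
    (Continuous.matrix_mulVec continuous_const continuous_id).measurable
  have hdet : A.det ≠ 0 := fun h => by simp [h] at hA
  have hvol : (volume : Measure (ι → ℝ)).map (fun z => A.mulVec z) = volume := by
    have h := Real.map_matrix_volume_pi_eq_smul_volume_pi hdet
    rw [abs_inv, hA, inv_one, ENNReal.ofReal_one, one_smul] at h
    exact h
  rw [pi_gaussianReal_eq_withDensity, lintegral_withDensity_eq_lintegral_mul _ hmeas (by fun_prop),
    lintegral_withDensity_eq_lintegral_mul _ hmeas hF]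
  conv_rhs => rw [← hvol, lintegral_map (by fun_prop) hAm]
  refine lintegral_congr fun z => ?_
  simp only [Pi.mul_apply]
  rw [mul_left_comm, mul_comm _ (F _), ← ENNReal.ofReal_mul
    (Finset.prod_nonneg fun i _ => gaussianPDFReal_nonneg _ _ _)]
  congr 2
  rw [prod_gaussianPDFReal, prod_gaussianPDFReal, mul_assoc, ← Real.exp_add]
  congr 2
  ring

/-- The change of measure inequality: for a unimodular matrix `A` whose log-likelihood ratio has
mean `D`, the probability of an event under the law of `A z` is controlled by `D` and its
probability under the law of `z`. -/
lemma mul_prob_le_of_change_of_variables [DecidableEq ι] {A : Matrix ι ι ℝ} (hA : |A.det| = 1)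
    {D : ℝ}
    (hgint : Integrable (fun z : ι → ℝ => (∑ i, A.mulVec z i ^ 2) / 2 - (∑ i, z i ^ 2) / 2)
      (Measure.pi fun _ : ι => gaussianReal 0 1))
    (hD : ∫ z : ι → ℝ, ((∑ i, A.mulVec z i ^ 2) / 2 - (∑ i, z i ^ 2) / 2)
      ∂(Measure.pi fun _ : ι => gaussianReal 0 1) = D)
    {E : Set (ι → ℝ)} (hE : MeasurableSet E) (t : ℝ) {c : ℝ} (hc : 0 < c) :
    t * (Measure.pi fun _ : ι => gaussianReal 0 1).real {z | A.mulVec z ∈ E} ≤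
      D + Real.log c - 1 +
        (1 + (Real.exp t - 1) * (Measure.pi fun _ : ι => gaussianReal 0 1).real E) / c := by
  set γ : Measure (ι → ℝ) := Measure.pi fun _ : ι => gaussianReal 0 1 with hγ
  have hAm : Measurable fun z : ι → ℝ => A.mulVec z :=
    (Continuous.matrix_mulVec continuous_const continuous_id).measurable
  have hEA : MeasurableSet {z | A.mulVec z ∈ E} := hAm hE
  set g : (ι → ℝ) → ℝ := fun z => (∑ i, A.mulVec z i ^ 2) / 2 - (∑ i, z i ^ 2) / 2 with hg
  set f : (ι → ℝ) → ℝ := E.indicator fun _ => t with hf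
  have hfm : Measurable f := measurable_const.indicator hE
  have hexpf : ∀ z, Real.exp (f z) = 1 + (Real.exp t - 1) * E.indicator (fun _ => (1 : ℝ)) z := by
    intro z
    by_cases hz : z ∈ E <;> simp [hf, hz]
  have hexpfi : Integrable (fun z => Real.exp (f z)) γ := by
    simp_rw [hexpf]
    exact (integrable_const _).add (((integrable_const _).indicator hE).const_mul _)
  have hexpfv : ∫ z, Real.exp (f z) ∂γ = 1 + (Real.exp t - 1) * γ.real E := by
    simp_rw [hexpf]
    rw [integral_add (integrable_const _) (((integrable_const _).indicator hE).const_mul _),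
      integral_const_mul, integral_indicator hE]
    simp
  have hgm : Measurable g := by fun_prop
  have hmain := lintegral_comp_mulVec_pi_gaussianReal hA
    (F := fun z => ENNReal.ofReal (Real.exp (f z))) (by fun_prop)
  have hprod : ∀ z, ENNReal.ofReal (Real.exp (f (A.mulVec z))) * ENNReal.ofReal
        (Real.exp ((∑ i, z i ^ 2) / 2 - (∑ i, A.mulVec z i ^ 2) / 2)) =
      ENNReal.ofReal (Real.exp (f (A.mulVec z) - g z)) := by
    intro z
    rw [← ENNReal.ofReal_mul (Real.exp_nonneg _), ← Real.exp_add]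
    congr 2
    simp only [hg]
    ring
  simp_rw [hprod] at hmain
  rw [← ofReal_integral_eq_lintegral_ofReal hexpfi (ae_of_all _ fun z => Real.exp_nonneg _)]
    at hmain
  have hxi : Integrable (fun z => Real.exp (f (A.mulVec z) - g z)) γ := by
    refine ⟨Measurable.aestronglyMeasurable (by fun_prop), ?_⟩
    rw [hasFiniteIntegral_iff_ofReal (ae_of_all _ fun z => Real.exp_nonneg _), hmain]
    exact ENNReal.ofReal_lt_top
  have hxv : ∫ z, Real.exp (f (A.mulVec z) - g z) ∂γ = ∫ z, Real.exp (f z) ∂γ := by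
    rw [integral_eq_lintegral_of_nonneg_ae (ae_of_all _ fun z => Real.exp_nonneg _)
      hxi.aestronglyMeasurable, hmain, ENNReal.toReal_ofReal
      (integral_nonneg fun z => Real.exp_nonneg _)]
  have hfA : ∀ z, f (A.mulVec z) = {z | A.mulVec z ∈ E}.indicator (fun _ => t) z := fun z => rfl
  have hfAi : Integrable (fun z => f (A.mulVec z)) γ := by
    simp_rw [hfA]
    exact (integrable_const _).indicator hEA
  have hfAv : ∫ z, f (A.mulVec z) ∂γ = t * γ.real {z | A.mulVec z ∈ E} := by
    simp_rw [hfA]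
    rw [integral_indicator hEA]
    simp [mul_comm]
  -- Donsker–Varadhan with the logarithm replaced by its tangent at `c`. The bound becomes linear in
  -- the probability of `E`, so it can be summed over many events before `c` is fixed.
  have hpt : ∀ z, f (A.mulVec z) - g z ≤
      Real.log c - 1 + Real.exp (f (A.mulVec z) - g z) / c := by
    intro z
    have h := Real.add_one_le_exp (f (A.mulVec z) - g z - Real.log c)
    rw [Real.exp_sub _ (Real.log c), Real.exp_log hc] at h
    linarith
  have hle := integral_mono (hfAi.sub hgint) ((integrable_const _).add (hxi.div_const c)) hpt
  simp only [Pi.sub_apply, Pi.add_apply] at hle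
  rw [integral_add (integrable_const _) (hxi.div_const c)] at hle
  rw [integral_sub hfAi hgint, hfAv, hD, integral_div, hxv, hexpfv] at hle
  simp only [integral_const, probReal_univ, one_smul] at hle
  linarith

lemma integral_sq_sum_pi_gaussianReal (v : ι → ℝ) :
    Integrable (fun z : ι → ℝ => (∑ k, v k * z k) ^ 2)
        (Measure.pi fun _ : ι => gaussianReal 0 1) ∧
      ∫ z : ι → ℝ, (∑ k, v k * z k) ^ 2 ∂(Measure.pi fun _ : ι => gaussianReal 0 1) =
        ∑ k, v k ^ 2 := by
  have hv : 0 ≤ ∑ k, v k ^ 2 := Finset.sum_nonneg fun k _ => sq_nonneg _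
  have hlaw : gaussianSum v = gaussianReal 0 (∑ k, v k ^ 2).toNNReal := by
    rw [gaussianReal_eq_gaussianSum]
    refine gaussianSum_congr fun L => ?_
    have hL : ∀ x : ℝ, L x = x * L 1 := fun x => by
      rw [← smul_eq_mul, ← map_smul, smul_eq_mul, mul_one]
    simp_rw [hL (v _), hL (√_), mul_pow, ← Finset.sum_mul]
    simp [Real.sq_sqrt, hv]
  have hm : AEMeasurable (fun z : ι → ℝ => ∑ k, z k • v k)
      (Measure.pi fun _ : ι => gaussianReal 0 1) := (measurable_sum_smul v).aemeasurable
  have hsm : AEStronglyMeasurable (fun x : ℝ => x ^ 2) (gaussianSum v) := by fun_prop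
  have hfun : (fun z : ι → ℝ => (∑ k, v k * z k) ^ 2) =
      (fun x : ℝ => x ^ 2) ∘ fun z : ι → ℝ => ∑ k, z k • v k := by
    ext z
    simp [mul_comm]
  have hi : Integrable (fun x : ℝ => x ^ 2) (gaussianSum v) := by
    rw [hlaw]
    exact (memLp_id_gaussianReal 2).integrable_sq
  constructor
  · rw [hfun]
    exact (integrable_map_measure hsm hm).1 hi
  · rw [hfun]
    have h := integral_map hm hsm
    simp only [Function.comp_def]
    rw [← h, ← gaussianSum, hlaw]
    have hvar := variance_id_gaussianReal (μ := 0) (v := (∑ k, v k ^ 2).toNNReal)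
    rw [variance_of_integral_eq_zero (by fun_prop) (by simp)] at hvar
    simpa [hv] using hvar

/-- For unimodular `A` this mean is the Kullback–Leibler divergence of the law of `A z` from that of
`z`: the determinant term vanishes. -/
lemma integral_logLikelihoodRatio (A : Matrix ι ι ℝ) :
    Integrable (fun z : ι → ℝ => (∑ i, A.mulVec z i ^ 2) / 2 - (∑ i, z i ^ 2) / 2)
        (Measure.pi fun _ : ι => gaussianReal 0 1) ∧
      ∫ z : ι → ℝ, ((∑ i, A.mulVec z i ^ 2) / 2 - (∑ i, z i ^ 2) / 2)
        ∂(Measure.pi fun _ : ι => gaussianReal 0 1) =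
          (∑ i, ∑ j, A i j ^ 2 - Fintype.card ι) / 2 := by
  classical
  have h1 := fun i => integral_sq_sum_pi_gaussianReal (A i)
  have h2 : ∀ i, Integrable (fun z : ι → ℝ => z i ^ 2)
        (Measure.pi fun _ : ι => gaussianReal 0 1) ∧
      ∫ z : ι → ℝ, z i ^ 2 ∂(Measure.pi fun _ : ι => gaussianReal 0 1) = 1 := fun i => by
    simpa [Pi.single_apply] using integral_sq_sum_pi_gaussianReal (Pi.single i (1 : ℝ))
  simp only [Matrix.mulVec, dotProduct]
  have i1 := integrable_finsetSum Finset.univ fun i _ => (h1 i).1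
  have i2 := integrable_finsetSum Finset.univ fun i _ => (h2 i).1
  refine ⟨(i1.div_const 2).sub (i2.div_const 2), ?_⟩
  rw [integral_sub (i1.div_const 2) (i2.div_const 2), integral_div, integral_div,
    integral_finsetSum _ fun i _ => (h1 i).1, integral_finsetSum _ fun i _ => (h2 i).1]
  simp only [(h1 _).2, (h2 _).2]
  simp
  ring

end ChangeOfVariables

/-! ### Gaussian arrays mixed by a matrix -/

section MixedLaw

variable {κ ν τ : Type*} [Fintype κ] [Fintype ν]

/-- The law of the array `(a, i) ↦ ∑ b, c b a * (A z_b) i`, where the `z_b` are independent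
standard Gaussian vectors. -/
def mixedLaw (c : κ → τ → ℂ) (A : Matrix ν ν ℝ) : Measure (τ → ν → ℂ) :=
  gaussianSum fun x : κ × ν => fun a i => c x.1 a * (A i x.2 : ℂ)

open scoped Kronecker in
-- Moves `A` onto the white noise, as a block-diagonal matrix followed by a map that does not
-- involve `A`. The change of measure can then be made on the noise, even when the law of the
-- samples is degenerate and has no density.
lemma mixedLaw_eq_map [DecidableEq κ] (c : κ → τ → ℂ) (A : Matrix ν ν ℝ) :
    mixedLaw c A = (Measure.pi fun _ : κ × ν => gaussianReal 0 1).map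
      fun z a i => ∑ b, c b a * ((((1 : Matrix κ κ ℝ) ⊗ₖ A).mulVec z (b, i) : ℝ) : ℂ) := by
  unfold mixedLaw gaussianSum
  congr 1
  ext z a i
  simp only [Finset.sum_apply, Pi.smul_apply, Complex.real_smul, Fintype.sum_prod_type,
    Matrix.mulVec, dotProduct, Matrix.kroneckerMap_apply, Matrix.one_apply, ite_mul, one_mul,
    zero_mul]
  refine Finset.sum_congr rfl fun b _ => ?_
  rw [Finset.sum_eq_single b (fun b' _ hb => by simp [hb.symm]) (by simp)]
  simp only [if_true, Complex.ofReal_sum, Complex.ofReal_mul, Finset.mul_sum]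
  exact Finset.sum_congr rfl fun j _ => by ring

open scoped Kronecker in
lemma mul_mixedLaw_le [DecidableEq ν] (C : κ → τ → ℂ) {A : Matrix ν ν ℝ} (hA : |A.det| = 1)
    {E : Set (τ → ν → ℂ)} (hE : MeasurableSet E) (t : ℝ) {c : ℝ} (hc : 0 < c) :
    t * (mixedLaw C A).real E ≤
      Fintype.card κ * (∑ i, ∑ j, A i j ^ 2 - Fintype.card ν) / 2 + Real.log c - 1 +
        (1 + (Real.exp t - 1) * (mixedLaw C 1).real E) / c := by
  classical
  set Φ : (κ × ν → ℝ) → τ → ν → ℂ := fun z a i => ∑ b, C b a * (z (b, i) : ℂ) with hΦ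
  have hΦm : Measurable Φ := by fun_prop
  set B : Matrix (κ × ν) (κ × ν) ℝ := (1 : Matrix κ κ ℝ) ⊗ₖ A with hB
  have hBm : Measurable fun z : κ × ν → ℝ => B.mulVec z :=
    (Continuous.matrix_mulVec continuous_const continuous_id).measurable
  have hdet : |B.det| = 1 := by
    rw [hB, Matrix.det_kronecker]
    simp [abs_pow, hA]
  have hfrob : ∑ x, ∑ y, B x y ^ 2 = Fintype.card κ * ∑ i, ∑ j, A i j ^ 2 := by
    simp only [hB, Fintype.sum_prod_type, Matrix.kroneckerMap_apply, Matrix.one_apply, ite_mul,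
      one_mul, zero_mul, ite_pow]
    simp [Finset.mul_sum]
  have h := mul_prob_le_of_change_of_variables hdet (integral_logLikelihoodRatio B).1
    (integral_logLikelihoodRatio B).2 (hΦm hE) t hc
  have h1 : (mixedLaw C A).real E = (Measure.pi fun _ : κ × ν => gaussianReal 0 1).real
      {z | B.mulVec z ∈ Φ ⁻¹' E} := by
    rw [mixedLaw_eq_map]
    exact map_measureReal_apply (hΦm.comp hBm) hE
  have h2 : (mixedLaw C (1 : Matrix ν ν ℝ)).real E =
      (Measure.pi fun _ : κ × ν => gaussianReal 0 1).real (Φ ⁻¹' E) := by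
    rw [mixedLaw_eq_map, map_measureReal_apply (by simpa using hΦm) hE]
    simp [hΦ]
  rw [h1, h2]
  refine h.trans (le_of_eq ?_)
  rw [hfrob, Fintype.card_prod]
  push_cast
  ring

end MixedLaw

section GaussianSum

variable {κ κ' E F : Type*} [Fintype κ] [Fintype κ'] [NormedAddCommGroup E] [NormedSpace ℝ E]
  [MeasurableSpace E] [BorelSpace E] [SecondCountableTopology E] [FiniteDimensional ℝ E]
  [NormedAddCommGroup F] [NormedSpace ℝ F] [MeasurableSpace F] [BorelSpace F]

lemma gaussianSum_map_of_isLinearMap (v : κ → E) {f : E → F} (hf : IsLinearMap ℝ f) :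
    (gaussianSum v).map f = gaussianSum fun k => f (v k) :=
  gaussianSum_map v (LinearMap.toContinuousLinearMap (hf.mk' f))

lemma gaussianSum_comp_equiv (v : κ → E) (e : κ' ≃ κ) :
    gaussianSum (fun k => v (e k)) = gaussianSum v :=
  have := FiniteDimensional.complete ℝ E
  gaussianSum_congr fun L => e.sum_comp fun k => L (v k) ^ 2

lemma mixedLaw_congr {ν τ : Type*} [Fintype ν] [Fintype τ] {d : κ → τ → ℂ} {c : κ' → τ → ℂ}
    (h : ∀ l : (τ → ℂ) →ₗ[ℝ] ℝ, ∑ k, l (d k) ^ 2 = ∑ k, l (c k) ^ 2) (A : Matrix ν ν ℝ) :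
    mixedLaw d A = mixedLaw c A := by
  refine gaussianSum_congr fun L => ?_
  rw [Fintype.sum_prod_type_right, Fintype.sum_prod_type_right]
  refine Finset.sum_congr rfl fun j _ => ?_
  let m : (τ → ℂ) →ₗ[ℝ] (τ → ν → ℂ) :=
    { toFun := fun y a i => y a * (A i j : ℂ)
      map_add' := fun x y => by ext; simp [add_mul]
      map_smul' := fun x y => by ext; simp [mul_assoc] }
  exact h (L.toLinearMap ∘ₗ m)

end GaussianSum

/-! ### The sample laws of systems with a frequency-independent inverse -/

lemma integral_exp_int (k : ℤ) :
    ∫ ω in (0 : ℝ)..(2 * Real.pi), Complex.exp (Complex.I * ω * k) =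
      if k = 0 then 2 * Real.pi else 0 := by
  split_ifs with hk
  · simp [hk]
  · have hc : Complex.I * k ≠ 0 := by simp [hk]
    have h : ∀ ω : ℝ, Complex.exp (Complex.I * ω * k) = Complex.exp (Complex.I * k * ω) :=
      fun ω => by ring_nf
    simp_rw [h]
    rw [integral_exp_mul_complex hc]
    have : Complex.I * k * ((2 * Real.pi : ℝ) : ℂ) = k * (2 * Real.pi * Complex.I) := by
      push_cast; ring
    rw [this, Complex.exp_int_mul_two_pi_mul_I]
    simp

/-- Fourier inversion for absolutely summable sequences. -/
lemma integral_dtft_mul_exp {a : ℤ → ℝ} (ha : Summable a) (k : ℤ) :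
    ∫ ω in (0 : ℝ)..(2 * Real.pi), dtft a ω * Complex.exp (Complex.I * ω * k) =
      2 * Real.pi * a k := by
  let f : ℤ → C(ℝ, ℂ) := fun l =>
    ⟨fun ω => (a l : ℂ) * Complex.exp (-(Complex.I * ω * l)) * Complex.exp (Complex.I * ω * k),
      by fun_prop⟩
  have hnorm : ∀ l ω, ‖f l ω‖ = |a l| := fun l ω => by
    have h1 : -(Complex.I * ω * l) = ((-(ω * l) : ℝ) : ℂ) * Complex.I := by push_cast; ring
    have h2 : Complex.I * ω * k = ((ω * k : ℝ) : ℂ) * Complex.I := by push_cast; ring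
    simp only [f, ContinuousMap.coe_mk, norm_mul, h1, h2, Complex.norm_exp_ofReal_mul_I, mul_one,
      Complex.norm_real, Real.norm_eq_abs]
  have hsum := intervalIntegral.hasSum_intervalIntegral_of_summable_norm (f := f) (a := 0)
    (b := 2 * Real.pi) (by
      refine Summable.of_nonneg_of_le (fun l => norm_nonneg _) (fun l => ?_) ha.abs
      rw [ContinuousMap.norm_le _ (abs_nonneg _)]
      exact fun x => (hnorm l x).le)
  have hval : ∀ l, ∫ ω in (0 : ℝ)..(2 * Real.pi), f l ω =
      if l = k then 2 * Real.pi * (a k : ℂ) else 0 := by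
    intro l
    have : ∀ ω : ℝ, f l ω = (a l : ℂ) * Complex.exp (Complex.I * ω * (k - l : ℤ)) := fun ω => by
      simp only [f, ContinuousMap.coe_mk, mul_assoc, ← Complex.exp_add]
      congr 2
      push_cast; ring
    simp_rw [this]
    rw [intervalIntegral.integral_const_mul, integral_exp_int]
    by_cases h : l = k
    · simp [h, mul_comm]
    · simp [h, sub_eq_zero, Ne.symm h]
  simp_rw [hval] at hsum
  have h := hsum.tsum_eq
  rw [tsum_ite_eq] at h
  rw [h]
  refine intervalIntegral.integral_congr fun ω _ => ?_
  simp only [dtft, f, ContinuousMap.coe_mk, tsum_mul_right]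

namespace LDS

variable {p : ℕ} {S : LDS p} {A : Matrix (Fin p) (Fin p) ℝ}

lemma psdm_eq (hA : ∀ ω, (1 - S.transfer ω)⁻¹ = A.map Complex.ofReal) (ω : ℝ) :
    S.psdm ω = S.noisePsd ω • (A * A.transpose).map Complex.ofReal := by
  rw [psdm, hA]
  ext i j
  simp [Matrix.mul_apply, Finset.mul_sum, mul_assoc]

/-- With `A` constant in the frequency, Fourier inversion acts on the noise spectrum alone, and time
separates from space. -/
lemma autocorr_eq (hA : ∀ ω, (1 - S.transfer ω)⁻¹ = A.map Complex.ofReal) (k : ℤ) :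
    S.autocorr k = S.r k • (A * A.transpose) := by
  ext i j
  have h : ∀ ω : ℝ, S.psdm ω i j * Complex.exp (Complex.I * ω * k) =
      ((A * A.transpose) i j : ℂ) * (dtft S.r ω * Complex.exp (Complex.I * ω * k)) := fun ω => by
    rw [psdm_eq hA]
    simp only [Matrix.smul_apply, Matrix.map_apply, smul_eq_mul, noisePsd]
    ring
  simp only [autocorr, Matrix.of_apply, h]
  rw [intervalIntegral.integral_const_mul, integral_dtft_mul_exp S.r_summable]
  have hpi : (Real.pi : ℂ) ≠ 0 := by exact_mod_cast Real.pi_ne_zero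
  have : (1 / (2 * Real.pi) : ℂ) * (((A * A.transpose) i j : ℂ) * (2 * Real.pi * S.r k)) =
      ((S.r k * (A * A.transpose) i j : ℝ) : ℂ) := by
    push_cast
    field_simp
  rw [this, Complex.ofReal_re]
  simp

lemma posSemidef_toeplitz (S : LDS p) (L : ℕ) :
    (Matrix.of fun s t : Fin L => S.r ((s : ℤ) - (t : ℤ))).PosSemidef := by
  refine Matrix.PosSemidef.of_dotProduct_mulVec_nonneg ?_ fun x => ?_
  · ext s t
    simp only [Matrix.conjTranspose_apply, Matrix.of_apply, star_trivial]
    rw [← S.r_symm, neg_sub]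
  · let e : Fin L ↪ ℤ := ⟨fun s => (s : ℤ), fun s t h => by simpa [Fin.ext_iff] using h⟩
    have h := S.r_posSemidef (Finset.univ.map e) (Function.extend e x 0)
    simp only [Finset.sum_map, e.injective.extend_apply] at h
    refine h.trans (le_of_eq ?_)
    simp only [dotProduct, Matrix.mulVec, star_trivial, Finset.mul_sum, Matrix.of_apply]
    refine Finset.sum_congr rfl fun s _ => Finset.sum_congr rfl fun t _ => ?_
    change x s * x t * S.r ((s : ℤ) - (t : ℤ)) = _
    ring

/-- The covariance of a window is the Kronecker product of a Toeplitz matrix and `A * A.transpose`,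
so factoring each side separately gives generators of product form. -/
lemma windowLaw_eq {L : ℕ} {B : Matrix (Fin L) (Fin L) ℝ}
    (hB : (Matrix.of fun s t : Fin L => S.r ((s : ℤ) - (t : ℤ))) = B * B.transpose)
    (hA : ∀ ω, (1 - S.transfer ω)⁻¹ = A.map Complex.ofReal) :
    S.windowLaw L = gaussianSum fun x : Fin L × Fin p => fun t i => B t x.1 * A i x.2 := by
  let C : Matrix (Fin L × Fin p) (Fin L × Fin p) ℝ := Matrix.of fun a b => B a.1 b.1 * A a.2 b.2
  have hC : (Matrix.of fun a b : Fin L × Fin p => S.autocorr ((a.1 : ℤ) - (b.1 : ℤ)) a.2 b.2) =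
      C * C.transpose := by
    ext a b
    have h := congrFun (congrFun hB a.1) b.1
    simp only [Matrix.of_apply] at h
    simp only [Matrix.of_apply, autocorr_eq hA, Matrix.smul_apply, h, smul_eq_mul,
      Matrix.mul_apply, C, Matrix.transpose_apply, Fintype.sum_prod_type, Finset.sum_mul_sum]
    exact Finset.sum_congr rfl fun s _ => Finset.sum_congr rfl fun t _ => by ring
  rw [windowLaw, hC, multivariateGaussian_eq_gaussianSum, gaussianSum_map_of_isLinearMap]
  · rfl
  · exact ⟨fun x y => rfl, fun c x => rfl⟩

end LDS

lemma isLinearMap_segmentDFT {p N : ℕ} (ω : ℝ) :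
    IsLinearMap ℝ (segmentDFT (p := p) (N := N) ω) := by
  constructor
  · intro x y
    ext i
    simp [segmentDFT, add_mul, Finset.sum_add_distrib, mul_add]
  · intro c x
    ext i
    simp only [segmentDFT, Pi.smul_apply, smul_eq_mul, Complex.ofReal_mul, Finset.mul_sum,
      Complex.real_smul]
    exact Finset.sum_congr rfl fun k _ => by ring

lemma segmentDFT_mul {p N : ℕ} (ω : ℝ) (x : Fin N → ℝ) (y : Fin p → ℝ) :
    segmentDFT ω (fun t i => x t * y i) = fun i =>
      segmentDFT (p := 1) ω (fun t _ => x t) 0 * (y i : ℂ) := by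
  ext i
  simp only [segmentDFT, Complex.ofReal_mul, mul_assoc, Finset.sum_mul]
  congr 1
  exact Finset.sum_congr rfl fun k _ => by ring

/-- The samples of all systems with the same noise whose inverse `(I - H)⁻¹` is a real matrix `A`
at all frequencies are obtained by mixing, with `A`, a common Gaussian array whose `p` columns are
independent with values in the `2 n`-dimensional real space `ℂⁿ`. -/
lemma exists_sampleLaw_eq_mixedLaw {p : ℕ} (S₀ : LDS p) (n : ℕ) (ω : ℝ) (s : Sampling) :
    ∃ c : ((_ : Fin n) × Fin 2) → Fin n → ℂ, ∀ (S : LDS p) (A : Matrix (Fin p) (Fin p) ℝ),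
      S.r = S₀.r → (∀ ω, (1 - S.transfer ω)⁻¹ = A.map Complex.ofReal) →
      S.sampleLaw n ω s = mixedLaw c A := by
  -- Any finite generating family will do: `exists_gram_eq` then compresses it to `2n` vectors, the
  -- real dimension of `ℂⁿ`.
  suffices H : ∃ (κ : Type) (_ : Fintype κ) (d : κ → Fin n → ℂ),
      ∀ (S : LDS p) (A : Matrix (Fin p) (Fin p) ℝ),
      S.r = S₀.r → (∀ ω, (1 - S.transfer ω)⁻¹ = A.map Complex.ofReal) →
      S.sampleLaw n ω s = mixedLaw d A by
    obtain ⟨κ, _, d, hd⟩ := H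
    obtain ⟨c, hc⟩ := exists_gram_eq (Pi.basis fun _ : Fin n => Complex.basisOneI) d
    exact ⟨c, fun S A hr hA => (hd S A hr hA).trans (mixedLaw_congr hc A)⟩
  cases s with
  | spectral =>
    refine ⟨Fin n × Bool, inferInstance, fun x a => if a = x.1 then
      ((√((S₀.noisePsd ω).re.toNNReal / 2) : ℝ) : ℂ) * (bif x.2 then Complex.I else 1) else 0,
      fun S A hr hA => ?_⟩
    have hψ : S.noisePsd ω = S₀.noisePsd ω := by rw [LDS.noisePsd, LDS.noisePsd, hr]
    have hlin : IsLinearMap ℝ fun e : Fin p → ℂ => (A.map Complex.ofReal).mulVec e :=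
      ⟨fun x y => Matrix.mulVec_add _ _ _, fun c x => Matrix.mulVec_smul _ _ _⟩
    simp only [LDS.sampleLaw, LDS.spectralLaw, complexGaussian_eq_gaussianSum, hA, hψ]
    rw [pi_gaussianSum, gaussianSum_map_of_isLinearMap _ hlin, pi_gaussianSum, mixedLaw,
      ← gaussianSum_comp_equiv _ ((Equiv.prodAssoc (Fin n) Bool (Fin p)).trans
        (Equiv.prodCongr (Equiv.refl _) (Equiv.prodComm _ _)))]
    congr 1
    ext x a i
    by_cases h : a = x.1.1
    · simp only [h, Equiv.trans_apply, Equiv.prodAssoc_apply, Equiv.prodCongr_apply, Prod.map,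
        Equiv.prodComm_apply, Prod.swap, Equiv.refl_apply, Pi.single_eq_same, Matrix.mulVec_single,
        if_true]
      exact mul_comm _ _
    · simp [h, Pi.single_eq_of_ne]
  | restartRecord N =>
    obtain ⟨B, hB⟩ := exists_eq_mul_transpose (S₀.posSemidef_toeplitz N)
    refine ⟨Fin n × Fin N, inferInstance, fun x a => if a = x.1 then
      segmentDFT (p := 1) ω (fun t _ => B t x.2) 0 else 0, fun S A hr hA => ?_⟩
    rw [← hr] at hB
    have hlin : IsLinearMap ℝ fun (y : Fin n → Fin N → Fin p → ℝ) a => segmentDFT ω (y a) :=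
      ⟨fun x y => funext fun a => (isLinearMap_segmentDFT ω).map_add _ _,
        fun c x => funext fun a => (isLinearMap_segmentDFT ω).map_smul _ _⟩
    simp only [LDS.sampleLaw, LDS.windowLaw_eq hB hA]
    rw [pi_gaussianSum, gaussianSum_map_of_isLinearMap _ hlin, mixedLaw,
      ← gaussianSum_comp_equiv _ (Equiv.prodAssoc (Fin n) (Fin N) (Fin p))]
    congr 1
    ext x a i
    by_cases h : a = x.1.1
    · simp [h, segmentDFT_mul]
    · simp [h, Pi.single_eq_of_ne, (isLinearMap_segmentDFT ω).map_zero]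
  | continuous N =>
    -- One factor for the entire trajectory, so that correlations between segments are retained in
    -- the generators.
    obtain ⟨B, hB⟩ := exists_eq_mul_transpose (S₀.posSemidef_toeplitz (n * N))
    refine ⟨Fin (n * N), inferInstance, fun x a =>
      segmentDFT (p := 1) ω (fun t _ => B (finProdFinEquiv (a, t)) x) 0, fun S A hr hA => ?_⟩
    rw [← hr] at hB
    have hlin : IsLinearMap ℝ fun (y : Fin (n * N) → Fin p → ℝ) (a : Fin n) =>
        segmentDFT ω fun k : Fin N => y (finProdFinEquiv (a, k)) :=
      ⟨fun x y => funext fun a => (isLinearMap_segmentDFT ω).map_add _ _,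
        fun c x => funext fun a => (isLinearMap_segmentDFT ω).map_smul _ _⟩
    simp only [LDS.sampleLaw, LDS.windowLaw_eq hB hA]
    rw [gaussianSum_map_of_isLinearMap _ hlin, mixedLaw]
    congr 1
    ext x a i
    rw [segmentDFT_mul]

/-! ### Eigenvalue bounds as bounds on Hermitian forms -/

section QuadraticForm

variable {ι : Type*} [Fintype ι]

lemma star_dotProduct_self (u : ι → ℂ) : star u ⬝ᵥ u = ((∑ i, ‖u i‖ ^ 2 : ℝ) : ℂ) := by
  simp only [dotProduct, Pi.star_apply, RCLike.star_def, Complex.ofReal_sum, Complex.ofReal_pow]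
  exact Finset.sum_congr rfl fun i _ => Complex.conj_mul' _

variable [DecidableEq ι]

lemma re_quadraticForm_mem {Φ : Matrix ι ι ℂ} (hΦ : Φ.IsHermitian) {a b : ℝ}
    (h : ∀ i, a ≤ hΦ.eigenvalues i ∧ hΦ.eigenvalues i ≤ b) (u : ι → ℂ) :
    a * ∑ i, ‖u i‖ ^ 2 ≤ (star u ⬝ᵥ Φ.mulVec u).re ∧
      (star u ⬝ᵥ Φ.mulVec u).re ≤ b * ∑ i, ‖u i‖ ^ 2 := by
  set U : Matrix ι ι ℂ := (hΦ.eigenvectorUnitary : Matrix ι ι ℂ) with hU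
  have hUU : U * U.conjTranspose = 1 := Unitary.coe_mul_star_self hΦ.eigenvectorUnitary
  set w : ι → ℂ := U.conjTranspose.mulVec u with hw
  have hstar : Matrix.vecMul (star u) U = star w := by
    rw [hw, Matrix.star_mulVec, Matrix.conjTranspose_conjTranspose]
  have hnorm : ∑ i, ‖w i‖ ^ 2 = ∑ i, ‖u i‖ ^ 2 := by
    have h1 := star_dotProduct_self w
    rw [← hstar, hw, ← Matrix.dotProduct_mulVec, Matrix.mulVec_mulVec, hUU, Matrix.one_mulVec,
      star_dotProduct_self] at h1
    exact_mod_cast h1.symm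
  have hform : (star u ⬝ᵥ Φ.mulVec u).re = ∑ i, hΦ.eigenvalues i * ‖w i‖ ^ 2 := by
    have h2 : Φ = U * Matrix.diagonal (RCLike.ofReal ∘ hΦ.eigenvalues) * U.conjTranspose :=
      hΦ.spectral_theorem
    conv_lhs => rw [h2]
    rw [← Matrix.mulVec_mulVec, ← Matrix.mulVec_mulVec, Matrix.dotProduct_mulVec, hstar, ← hw]
    simp only [dotProduct, Matrix.mulVec_diagonal, Pi.star_apply, Function.comp_apply,
      Complex.re_sum]
    refine Finset.sum_congr rfl fun i _ => ?_
    have : star (w i) * (RCLike.ofReal (hΦ.eigenvalues i) * w i) =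
        ((hΦ.eigenvalues i * ‖w i‖ ^ 2 : ℝ) : ℂ) := by
      push_cast
      rw [← Complex.conj_mul']
      simp only [RCLike.star_def, Complex.coe_algebraMap]
      ring_nf
    rw [this, Complex.ofReal_re]
  rw [hform, ← hnorm, Finset.mul_sum, Finset.mul_sum]
  exact ⟨Finset.sum_le_sum fun i _ => mul_le_mul_of_nonneg_right (h i).1 (sq_nonneg _),
    Finset.sum_le_sum fun i _ => mul_le_mul_of_nonneg_right (h i).2 (sq_nonneg _)⟩

lemma re_quadraticForm_mul_conjTranspose (P : Matrix ι ι ℂ) (σ : ℝ) (u : ι → ℂ) :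
    (star u ⬝ᵥ (P * ((σ : ℂ) • (1 : Matrix ι ι ℂ)) * P.conjTranspose).mulVec u).re =
      σ * ∑ i, ‖P.conjTranspose.mulVec u i‖ ^ 2 := by
  have h : Matrix.vecMul (star u) P = star (P.conjTranspose.mulVec u) := by
    rw [Matrix.star_mulVec, Matrix.conjTranspose_conjTranspose]
  rw [Matrix.mul_smul, Matrix.mul_one, Matrix.smul_mul, Matrix.smul_mulVec, ← Matrix.mulVec_mulVec,
    dotProduct_smul, Matrix.dotProduct_mulVec, h, star_dotProduct_self, smul_eq_mul,
    ← Complex.ofReal_mul, Complex.ofReal_re]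

end QuadraticForm

/-! ### What a system with edges imposes on `σ`, `β` and `M` -/

section Attained

variable {p q : ℕ} {β M : ℝ} {σ : ℝ → ℝ} {S : LDS p}

lemma transfer_eq_zero {i j : Fin p} (h : ¬ S.graph.Adj j i) (ω : ℝ) : S.transfer ω i j = 0 := by
  have h0 : S.h i j = 0 := not_not.1 h
  simp [LDS.transfer, dtft, h0]

lemma family_quadraticForm (hS : S ∈ family p q β σ M) {ω : ℝ}
    (hω : ω ∈ Set.Icc 0 (2 * Real.pi)) (u : Fin p → ℂ) :
    M⁻¹ * ∑ i, ‖u i‖ ^ 2 ≤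
        σ ω * ∑ i, ‖((1 - S.transfer ω)⁻¹).conjTranspose.mulVec u i‖ ^ 2 ∧
      σ ω * ∑ i, ‖((1 - S.transfer ω)⁻¹).conjTranspose.mulVec u i‖ ^ 2 ≤
        M * ∑ i, ‖u i‖ ^ 2 := by
  obtain ⟨-, hψ, he⟩ := hS.2 ω hω
  have h := re_quadraticForm_mem (S.psdm_isHermitian ω) he u
  rwa [LDS.psdm, hψ, re_quadraticForm_mul_conjTranspose] at h

lemma family_inverse (hM : 1 < M) (hS : S ∈ family p q β σ M) {ω : ℝ}
    (hω : ω ∈ Set.Icc 0 (2 * Real.pi)) (i : Fin p) :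
    0 < σ ω ∧ (1 - S.transfer ω) * (1 - S.transfer ω)⁻¹ = 1 := by
  have h := (family_quadraticForm hS hω (Pi.single i 1)).1
  have h1 : ∑ k, ‖(Pi.single i 1 : Fin p → ℂ) k‖ ^ 2 = 1 := by
    rw [Finset.sum_eq_single i (fun k _ hk => by simp [hk]) (by simp)]
    simp
  have hpos : 0 < M⁻¹ := inv_pos.2 (by linarith)
  rw [h1, mul_one] at h
  have h2 := hpos.trans_le h
  refine ⟨pos_of_mul_pos_left h2 (Finset.sum_nonneg fun k _ => sq_nonneg _), ?_⟩
  refine Matrix.mul_nonsing_inv _ ?_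
  -- If `1 - H` were singular, its inverse would take the default value `0` and the form would
  -- vanish, against the lower bound `M⁻¹`.
  by_contra hdet
  rw [Matrix.nonsing_inv_apply_not_isUnit _ hdet] at h2
  simp at h2

/-- Take a node that is minimal, for the ancestor order, among those having a parent: its parents
then have none. -/
lemma exists_edge_from_sources (hac : IsAcyclic S.graph) (hne : ∃ i j, S.graph.Adj j i) :
    ∃ i j, S.graph.Adj j i ∧ ∀ k, S.graph.Adj k i → ∀ l, ¬ S.graph.Adj l k := by
  have : Std.Irrefl (Relation.TransGen S.graph.Adj) := ⟨hac⟩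
  have hwf : WellFounded (Relation.TransGen S.graph.Adj) :=
    Finite.wellFounded_of_trans_of_irrefl _
  obtain ⟨i, ⟨j, hj⟩, hmin⟩ := hwf.has_min {i | ∃ j, S.graph.Adj j i} hne
  exact ⟨i, j, hj, fun k hk l hl => hmin k ⟨l, hl⟩ (Relation.TransGen.single hk)⟩

lemma sq_norm_pair_le_sum {ι : Type*} [Fintype ι] {i j : ι} (hij : i ≠ j)
    (u : ι → ℂ) : ‖u i‖ ^ 2 + ‖u j‖ ^ 2 ≤ ∑ k, ‖u k‖ ^ 2 := by
  classical
  rw [← Finset.sum_pair (f := fun k => ‖u k‖ ^ 2) hij]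
  exact Finset.sum_le_sum_of_subset_of_nonneg (Finset.subset_univ _) fun _ _ _ => sq_nonneg _

lemma sum_sq_norm_single_add_single {ι : Type*} [Fintype ι] [DecidableEq ι] {i j : ι}
    (hij : i ≠ j) (x y : ℂ) :
    ∑ k, ‖(Pi.single i x + Pi.single j y : ι → ℂ) k‖ ^ 2 = ‖x‖ ^ 2 + ‖y‖ ^ 2 := by
  rw [← Finset.sum_subset (Finset.subset_univ {i, j}), Finset.sum_pair hij]
  · simp [hij, hij.symm]
  · intro k _ hk
    simp only [Finset.mem_insert, Finset.mem_singleton, not_or] at hk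
    simp [hk.1, hk.2]

/-- A system of the family with at least one edge leaves room, at each frequency, for the
extreme singular values of a single edge of gain `β`. -/
lemma family_edge_bounds (hβ : 0 < β) (hM : 1 < M) (hS : S ∈ family p q β σ M)
    (hne : ∃ i j, S.graph.Adj j i) {s : ℝ} (hs : 0 < s) (hs2 : s ^ 2 = 1 + β * s) {ω : ℝ}
    (hω : ω ∈ Set.Icc 0 (2 * Real.pi)) :
    σ ω * s ^ 2 ≤ M ∧ s ^ 2 ≤ M * σ ω := by
  obtain ⟨i, j, hji, hsrc⟩ := exists_edge_from_sources hS.1.1 hne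
  obtain ⟨hσ, hinv⟩ := family_inverse hM hS hω i
  have hβg := (hS.2 ω hω).1 i j hji
  have hij : i ≠ j := by
    rintro rfl
    exact hS.1.1 i (Relation.TransGen.single hji)
  have hHii : S.transfer ω i i = 0 :=
    transfer_eq_zero (fun h => hS.1.1 i (Relation.TransGen.single h)) ω
  have hHj : ∀ k, S.transfer ω j k = 0 := fun k => transfer_eq_zero (hsrc j hji k) ω
  set H := S.transfer ω with hH
  set P := (1 - H)⁻¹ with hP
  set g := H i j with hg
  have hP1 : P = 1 + H * P := by
    rw [sub_mul, one_mul] at hinv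
    rw [← hinv]; abel
  have hPsrc : ∀ l, (∀ k, ¬ S.graph.Adj k l) → ∀ k, P l k = (1 : Matrix (Fin p) (Fin p) ℂ) l k := by
    intro l hl k
    have := congrFun (congrFun hP1 l) k
    rw [this, Matrix.add_apply, Matrix.mul_apply, Finset.sum_eq_zero, add_zero]
    intro m _
    rw [hH, transfer_eq_zero (hl m), zero_mul]
  have hPi : ∀ k, P i k = (1 : Matrix (Fin p) (Fin p) ℂ) i k + H i k := by
    intro k
    have := congrFun (congrFun hP1 i) k
    rw [this, Matrix.add_apply, Matrix.mul_apply]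
    congr 1
    have : ∀ l, H i l * P l k = H i l * (1 : Matrix (Fin p) (Fin p) ℂ) l k := by
      intro l
      by_cases hl : S.graph.Adj l i
      · rw [hPsrc l (hsrc l hl)]
      · rw [hH, transfer_eq_zero hl, zero_mul, zero_mul]
    simp_rw [this]
    simp [Matrix.one_apply]
  have hPj := hPsrc j (hsrc j hji)
  have hgpos : 0 < ‖g‖ := hβ.trans_le hβg
  -- The phase that aligns the two contributions at `j`, so that their moduli add up to `‖g‖ * s + 1
  -- ≥ β * s + 1 = s ^ 2`.
  set θ : ℂ := (starRingEnd ℂ) g / ‖g‖ with hθ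
  have hθn : ‖θ‖ = 1 := by
    rw [hθ, norm_div, RCLike.norm_conj, Complex.norm_real, norm_norm, div_self hgpos.ne']
  have hsum : s ^ 2 ≤ ‖(starRingEnd ℂ) g * s + θ‖ := by
    have : (starRingEnd ℂ) g * s + θ = (starRingEnd ℂ) g * ((s + 1 / ‖g‖ : ℝ) : ℂ) := by
      rw [hθ]; push_cast; ring
    rw [this, norm_mul, RCLike.norm_conj, Complex.norm_real, Real.norm_eq_abs,
      abs_of_pos (by positivity), mul_add, mul_one_div_cancel hgpos.ne', hs2]
    nlinarith
  have hsum2 : (s ^ 2) ^ 2 ≤ ‖(starRingEnd ℂ) g * s + θ‖ ^ 2 :=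
    pow_le_pow_left₀ (sq_nonneg s) hsum 2
  have hsn : ‖(s : ℂ)‖ ^ 2 = s ^ 2 := by
    rw [Complex.norm_real, Real.norm_eq_abs, sq_abs]
  constructor
  -- For gain exactly `β`, `(s, θ)` is the top singular vector of the shear on `{i, j}`; the
  -- coordinates `i` and `j` of the image alone give the factor `s ^ 2`.
  · have h := (family_quadraticForm hS hω (Pi.single i (s : ℂ) + Pi.single j θ)).2
    rw [sum_sq_norm_single_add_single hij, hθn, hsn] at h
    have h1 := sq_norm_pair_le_sum hij
      (P.conjTranspose.mulVec (Pi.single i (s : ℂ) + Pi.single j θ))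
    have hi : P.conjTranspose.mulVec (Pi.single i (s : ℂ) + Pi.single j θ) i = s := by
      simp [Matrix.mulVec_add, hPi, hPj, hHii, hij.symm]
    have hj : P.conjTranspose.mulVec (Pi.single i (s : ℂ) + Pi.single j θ) j =
        (starRingEnd ℂ) g * s + θ := by
      simp [Matrix.mulVec_add, hPi, hPj, hij, hg, mul_comm]
    rw [hi, hj, hsn] at h1
    have h2 := (mul_le_mul_of_nonneg_left h1 hσ.le).trans h
    have h3 : (σ ω * s ^ 2) * (1 + s ^ 2) ≤ M * (1 + s ^ 2) := by nlinarith
    exact le_of_mul_le_mul_right h3 (by positivity)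
  -- The same for the inverse `1 - H`, whose off-diagonal sign is opposite, hence `-θ`.
  · have h := (family_quadraticForm hS hω
      ((1 - H).conjTranspose.mulVec (Pi.single i (s : ℂ) + Pi.single j (-θ)))).1
    rw [Matrix.mulVec_mulVec, ← Matrix.conjTranspose_mul, ← hH, hinv, Matrix.conjTranspose_one,
      Matrix.one_mulVec, sum_sq_norm_single_add_single hij, norm_neg, hθn, hsn] at h
    have h1 := sq_norm_pair_le_sum hij
      ((1 - H).conjTranspose.mulVec (Pi.single i (s : ℂ) + Pi.single j (-θ)))
    have hi : (1 - H).conjTranspose.mulVec (Pi.single i (s : ℂ) + Pi.single j (-θ)) i = s := by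
      simp [Matrix.mulVec_add, hHii, hHj, hij]
    have hj : (1 - H).conjTranspose.mulVec (Pi.single i (s : ℂ) + Pi.single j (-θ)) j =
        -((starRingEnd ℂ) g * s + θ) := by
      simp [Matrix.mulVec_add, hHj, hij.symm, hg]
      ring
    rw [hi, hj, hsn, norm_neg] at h1
    have hM0 : 0 < M := by linarith
    rw [inv_mul_le_iff₀ hM0] at h
    have h3 : s ^ 2 * (1 + s ^ 2) ≤ (M * σ ω) * (1 + s ^ 2) := by nlinarith
    exact le_of_mul_le_mul_right h3 (by positivity)

/-- Test the lower spectral bound on the conjugated row `i` of `1 - H`: it is sent to a unit vector,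
while its own squared norm collects `1` and at least `β ^ 2` per parent. -/
lemma family_parents_bound (hβ : 0 < β) (hM : 1 < M) (hS : S ∈ family p q β σ M) {i : Fin p}
    (hi : (parents S.graph i).ncard = q) {ω : ℝ} (hω : ω ∈ Set.Icc 0 (2 * Real.pi)) :
    1 + q * β ^ 2 ≤ M * σ ω := by
  classical
  obtain ⟨hσ, hinv⟩ := family_inverse hM hS hω i
  have h := (family_quadraticForm hS hω
      ((1 - S.transfer ω).conjTranspose.mulVec (Pi.single i 1))).1
  rw [Matrix.mulVec_mulVec, ← Matrix.conjTranspose_mul, hinv, Matrix.conjTranspose_one,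
    Matrix.one_mulVec] at h
  have h1 : ∑ k, ‖(Pi.single i 1 : Fin p → ℂ) k‖ ^ 2 = 1 := by
    rw [Finset.sum_eq_single i (fun k _ hk => by simp [hk]) (by simp)]
    simp
  rw [h1, mul_one, inv_mul_le_iff₀ (by linarith)] at h
  refine le_trans ?_ h
  have hirr : ¬ S.graph.Adj i i := fun h => hS.1.1 i (Relation.TransGen.single h)
  have hi' : i ∉ (parents S.graph i).toFinset := fun h => hirr (Set.mem_toFinset.1 h)
  have hcard : (parents S.graph i).toFinset.card = q := by
    rw [← hi, Set.ncard_eq_toFinset_card']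
  refine le_trans ?_ (Finset.sum_le_sum_of_subset_of_nonneg
    (Finset.subset_univ (insert i (parents S.graph i).toFinset)) fun _ _ _ => sq_nonneg _)
  rw [Finset.sum_insert hi', ← hcard, ← nsmul_eq_mul]
  refine add_le_add ?_ (Finset.card_nsmul_le_sum _ _ _ fun j hj => ?_)
  · simp [transfer_eq_zero hirr]
  · have hj' : S.graph.Adj j i := Set.mem_toFinset.1 hj
    have hij : i ≠ j := by
      rintro rfl
      exact hirr hj'
    have hb := (hS.2 ω hω).1 i j hj'
    simpa [hij.symm] using pow_le_pow_left₀ hβ.le hb 2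

end Attained

/-- The largest singular value of the shear `!![1, 0; β, 1]` is the positive root of
`s ^ 2 = 1 + β * s`. -/
lemma exists_shear_singularValue {β : ℝ} (hβ : 0 < β) : ∃ s : ℝ, 0 < s ∧ s ^ 2 = 1 + β * s := by
  have h := Real.sq_sqrt (show 0 ≤ β ^ 2 + 4 by positivity)
  exact ⟨(β + √(β ^ 2 + 4)) / 2, by positivity, by linear_combination h / 4⟩

/-! ### Matching matrices: determinant, Frobenius norm, operator norm -/

section Matching

variable {ν : Type*} [DecidableEq ν] {b : ℝ} {T : Finset ν} {f : ν → ν}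

/-- The matrix with entry `b` at `(i, f i)` for `i ∈ T`, and zeros elsewhere. -/
def matchingMatrix (b : ℝ) (T : Finset ν) (f : ν → ν) : Matrix ν ν ℝ :=
  Matrix.of fun i j => if i ∈ T ∧ f i = j then b else 0

lemma matchingMatrix_apply (i j : ν) :
    matchingMatrix b T f i j = if i ∈ T ∧ f i = j then b else 0 := rfl

lemma matchingMatrix_self (hf : ∀ i ∈ T, f i ∉ T) (i : ν) : matchingMatrix b T f i i = 0 :=
  if_neg fun h : i ∈ T ∧ f i = i => hf i h.1 (h.2.symm ▸ h.1)

lemma matchingMatrix_neg : matchingMatrix (-b) T f = -matchingMatrix b T f := by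
  ext i j
  simp only [matchingMatrix_apply, Matrix.neg_apply]
  split_ifs <;> simp

variable [Fintype ν]

lemma matchingMatrix_mul_self (hf : ∀ i ∈ T, f i ∉ T) :
    matchingMatrix b T f * matchingMatrix b T f = 0 := by
  ext i k
  rw [Matrix.mul_apply, Matrix.zero_apply]
  refine Finset.sum_eq_zero fun j _ => ?_
  simp only [matchingMatrix_apply]
  by_cases h1 : i ∈ T ∧ f i = j
  · rw [if_neg (fun h : j ∈ T ∧ f j = k => hf i h1.1 (h1.2 ▸ h.1)), mul_zero]
  · rw [if_neg h1, zero_mul]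

lemma one_sub_mul_one_add_matchingMatrix (hf : ∀ i ∈ T, f i ∉ T) :
    (1 - matchingMatrix b T f) * (1 + matchingMatrix b T f) = 1 := by
  rw [sub_mul, mul_add, mul_add, one_mul, one_mul, mul_one, matchingMatrix_mul_self hf]
  abel

lemma abs_det_one_add_matchingMatrix (hf : ∀ i ∈ T, f i ∉ T) :
    |(1 + matchingMatrix b T f).det| = 1 := by
  let d : ν → ℝ := fun i => if i ∈ T then -1 else 1
  have hd : ∀ i, d i * d i = 1 := fun i => by simp only [d]; split_ifs <;> norm_num
  -- Flipping signs on `T` conjugates `1 + N` to `1 - N`, its inverse; the determinant thus equals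
  -- its own inverse.
  have hconj : Matrix.diagonal d * (1 + matchingMatrix b T f) * Matrix.diagonal d =
      1 - matchingMatrix b T f := by
    ext i j
    rw [Matrix.mul_diagonal, Matrix.diagonal_mul, Matrix.add_apply, Matrix.sub_apply]
    by_cases hij : i = j
    · subst hij
      rw [matchingMatrix_self hf, Matrix.one_apply_eq, mul_right_comm, hd]
      ring
    · rw [Matrix.one_apply_ne hij, matchingMatrix_apply]
      split_ifs with h
      · have hj : j ∉ T := h.2 ▸ hf i h.1
        simp [d, h.1, hj]
      · simp
  have h1 : (1 - matchingMatrix b T f).det = (1 + matchingMatrix b T f).det := by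
    rw [← hconj, Matrix.det_mul, Matrix.det_mul, mul_right_comm, ← Matrix.det_mul,
      Matrix.diagonal_mul_diagonal]
    simp [hd]
  have h2 := congrArg Matrix.det (one_sub_mul_one_add_matchingMatrix (b := b) hf)
  rw [Matrix.det_mul, Matrix.det_one, h1, ← sq, ← sq_abs] at h2
  exact (pow_eq_one_iff_of_nonneg (abs_nonneg _) two_ne_zero).1 h2

lemma sum_sq_one_add_matchingMatrix (hf : ∀ i ∈ T, f i ∉ T) :
    ∑ i, ∑ j, (1 + matchingMatrix b T f) i j ^ 2 = Fintype.card ν + T.card * b ^ 2 := by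
  have h : ∀ i j, (1 + matchingMatrix b T f) i j ^ 2 =
      (if i = j then 1 else 0) + if i ∈ T ∧ f i = j then b ^ 2 else 0 := by
    intro i j
    rw [Matrix.add_apply]
    by_cases hij : i = j
    · subst hij
      have : ¬ (i ∈ T ∧ f i = i) := fun h => hf i h.1 (h.2.symm ▸ h.1)
      rw [matchingMatrix_self hf]
      simp [this]
    · simp [matchingMatrix_apply, hij]
  simp_rw [h, Finset.sum_add_distrib, ite_and]
  simp

/-- The norm of `(1 + N)ᵀ`, for a matching matrix `N` of gain `b`, is at most the largest singular
value `s` of a `2 × 2` shear of gain `|b|`. -/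
lemma sum_sq_one_add_matchingMatrix_le (hf : ∀ i ∈ T, f i ∉ T) (hinj : Set.InjOn f T) {s : ℝ}
    (hs : 0 < s) (hs2 : s ^ 2 = 1 + |b| * s) (v : ν → ℂ) :
    ∑ k, ‖((1 + matchingMatrix b T f).map Complex.ofReal).conjTranspose.mulVec v k‖ ^ 2 ≤
      s ^ 2 * ∑ k, ‖v k‖ ^ 2 := by
  have hs1 : 1 ≤ s ^ 2 := by rw [hs2]; nlinarith [abs_nonneg b]
  have hval : ∀ k, ((1 + matchingMatrix b T f).map Complex.ofReal).conjTranspose.mulVec v k =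
      v k + ∑ i ∈ T, if f i = k then (b : ℂ) * v i else 0 := by
    intro k
    simp only [Matrix.mulVec, dotProduct, Matrix.conjTranspose_apply, Matrix.map_apply,
      Matrix.add_apply, RCLike.star_def, Complex.ofReal_add, map_add, Complex.conj_ofReal, add_mul,
      Finset.sum_add_distrib, matchingMatrix_apply]
    congr 1
    · rw [Finset.sum_eq_single k (fun i _ hi => by simp [hi]) (by simp)]
      simp
    · rw [← Finset.sum_subset (Finset.subset_univ T) fun i _ hi => by simp [hi]]
      refine Finset.sum_congr rfl fun i hi => ?_
      by_cases h : f i = k <;> simp [hi, h]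
  -- Each `i ∈ T` passes `(s ^ 2 - 1) * ‖v i‖ ^ 2` of its share to its partner `f i`; by injectivity
  -- a partner receives from only one node, and the transfers cancel in the sum.
  have hpt : ∀ k, ‖v k + ∑ i ∈ T, if f i = k then (b : ℂ) * v i else 0‖ ^ 2 ≤
      (s ^ 2 * ‖v k‖ ^ 2 - if k ∈ T then (s ^ 2 - 1) * ‖v k‖ ^ 2 else 0) +
        ∑ i ∈ T, if f i = k then (s ^ 2 - 1) * ‖v i‖ ^ 2 else 0 := by
    intro k
    by_cases hk : ∃ i ∈ T, f i = k
    · obtain ⟨i, hi, rfl⟩ := hk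
      have hne : ∀ j ∈ T, j ≠ i → f j ≠ f i := fun j hj hji h => hji (hinj hj hi h)
      rw [if_neg (hf i hi), Finset.sum_eq_single i (fun j hj hji => if_neg (hne j hj hji))
        (fun h => absurd hi h), Finset.sum_eq_single i (fun j hj hji => if_neg (hne j hj hji))
        (fun h => absurd hi h), if_pos rfl, if_pos rfl]
      have h1 : ‖v (f i) + b * v i‖ ≤ ‖v (f i)‖ + |b| * ‖v i‖ := by
        refine (norm_add_le _ _).trans_eq ?_
        rw [norm_mul, Complex.norm_real, Real.norm_eq_abs]
      have h2 := pow_le_pow_left₀ (norm_nonneg _) h1 2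
      refine h2.trans ?_
      have hb : |b| = s - 1 / s := by field_simp; linarith
      -- The deficit is a perfect square because `|b| = s - 1 / s`.
      have h3 : s ^ 2 * ‖v (f i)‖ ^ 2 - 0 + (s ^ 2 - 1) * ‖v i‖ ^ 2 -
          (‖v (f i)‖ + |b| * ‖v i‖) ^ 2 = |b| / s * (s * ‖v (f i)‖ - ‖v i‖) ^ 2 := by
        rw [hb]; field_simp; ring
      have h4 : 0 ≤ |b| / s * (s * ‖v (f i)‖ - ‖v i‖) ^ 2 := by positivity
      linarith
    · have h0 : ∀ i ∈ T, f i ≠ k := fun i hi h => hk ⟨i, hi, h⟩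
      rw [Finset.sum_eq_zero fun i hi => if_neg (h0 i hi),
        Finset.sum_eq_zero fun i hi => if_neg (h0 i hi)]
      split_ifs
      · simp only [add_zero]; linarith
      · simp only [add_zero, sub_zero]
        nlinarith [sq_nonneg ‖v k‖]
  simp_rw [hval]
  refine (Finset.sum_le_sum fun k _ => hpt k).trans (le_of_eq ?_)
  rw [Finset.sum_add_distrib, Finset.sum_sub_distrib, Finset.sum_comm (s := Finset.univ) (t := T),
    Finset.mul_sum]
  simp

end Matching

/-! ### The hard instances and their membership in the family -/

section MatchingSystem

variable {p q : ℕ} {β M : ℝ} {σ : ℝ → ℝ} {S₀ : LDS p} {T : Finset (Fin p)} {f : Fin p → Fin p}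

lemma dtft_single (a ω : ℝ) : dtft (Pi.single 0 a) ω = a := by
  rw [dtft, tsum_eq_single 0 fun k hk => by simp [hk]]
  simp

/-- The memoryless system `x_i = β x_{f i} + e_i` for `i ∈ T` and `x_i = e_i` for `i ∉ T`, with the
noise of the system `S₀`. -/
def matchingSystem (S₀ : LDS p) (β : ℝ) (T : Finset (Fin p)) (f : Fin p → Fin p)
    (hf : ∀ i ∈ T, f i ∉ T) : LDS p where
  h i j := Pi.single 0 (matchingMatrix β T f i j)
  h_summable i j := summable_of_hasFiniteSupport
    ((Set.finite_singleton 0).subset (Pi.support_single_subset))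
  acyclic := by
    -- Every edge leads from the complement of `T` into `T`, so a path cannot close up.
    have key : ∀ i j, Relation.TransGen (filterGraph fun i j : Fin p =>
        (Pi.single 0 (matchingMatrix β T f i j) : ℤ → ℝ)).Adj i j → i ∉ T ∧ j ∈ T := by
      have hadj : ∀ i j, (filterGraph fun i j : Fin p =>
          (Pi.single 0 (matchingMatrix β T f i j) : ℤ → ℝ)).Adj i j → i ∉ T ∧ j ∈ T := by
        intro i j h
        by_cases hT : j ∈ T ∧ f j = i
        · exact ⟨hT.2 ▸ hf j hT.1, hT.1⟩
        · exact absurd (by simp [matchingMatrix_apply, hT]) h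
      intro i j h
      induction h with
      | single h => exact hadj _ _ h
      | tail _ h ih => exact ⟨ih.1, (hadj _ _ h).2⟩
    exact fun i h => (key i i h).1 (key i i h).2
  r := S₀.r
  r_summable := S₀.r_summable
  r_symm := S₀.r_symm
  r_posSemidef := S₀.r_posSemidef

variable {hf : ∀ i ∈ T, f i ∉ T}

lemma matchingSystem_adj (hβ : 0 < β) {i j : Fin p} :
    (matchingSystem S₀ β T f hf).graph.Adj j i ↔ i ∈ T ∧ f i = j := by
  change (Pi.single 0 (matchingMatrix β T f i j) : ℤ → ℝ) ≠ 0 ↔ _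
  rw [Ne, Pi.single_eq_zero_iff, matchingMatrix_apply]
  simp [hβ.ne']

lemma transfer_matchingSystem (ω : ℝ) :
    (matchingSystem S₀ β T f hf).transfer ω = (matchingMatrix β T f).map Complex.ofReal := by
  ext i j
  exact dtft_single _ _

lemma inverse_matchingSystem (ω : ℝ) :
    (1 - (matchingSystem S₀ β T f hf).transfer ω)⁻¹ =
      (1 + matchingMatrix β T f).map Complex.ofReal := by
  refine Matrix.inv_eq_right_inv ?_
  have h := congrArg (fun A : Matrix (Fin p) (Fin p) ℝ => A.map Complex.ofRealHom)
    (one_sub_mul_one_add_matchingMatrix (b := β) hf)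
  simp only [Matrix.map_mul] at h
  rw [Matrix.map_sub _ (map_sub _), Matrix.map_one _ (map_zero _) (map_one _)] at h
  rw [transfer_matchingSystem]
  exact h

lemma matchingSystem_mem_family (hq : 1 ≤ q) (hβ : 0 < β) (hM : 1 < M)
    (hS : S₀ ∈ family p q β σ M) (hne : ∃ i j, S₀.graph.Adj j i) (hinj : Set.InjOn f T) :
    matchingSystem S₀ β T f hf ∈ family p q β σ M := by
  obtain ⟨s, hs, hs2⟩ := exists_shear_singularValue hβ
  refine ⟨⟨(matchingSystem S₀ β T f hf).acyclic, fun i => ?_⟩, fun ω hω => ⟨fun i j h => ?_, ?_, ?_⟩⟩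
  · have hsub : parents (matchingSystem S₀ β T f hf).graph i ⊆ {f i} := fun j hj =>
      ((matchingSystem_adj hβ).1 hj).2.symm
    exact (Set.ncard_le_ncard hsub).trans (by simpa using hq)
  · rw [transfer_matchingSystem, Matrix.map_apply, matchingMatrix_apply,
      if_pos ((matchingSystem_adj hβ).1 h), Complex.norm_real, Real.norm_eq_abs]
    exact le_abs_self β
  · exact (hS.2 ω hω).2.1
  · obtain ⟨i₀, -⟩ := id hne
    have hσ := (family_inverse hM hS hω i₀).1
    obtain ⟨hup, hlo⟩ := family_edge_bounds hβ hM hS hne hs hs2 hω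
    intro i
    set v : Fin p → ℂ :=
      ⇑(((matchingSystem S₀ β T f hf).psdm_isHermitian ω).eigenvectorBasis i) with hv
    have hnorm : ∑ k, ‖v k‖ ^ 2 = 1 := by
      have := (((matchingSystem S₀ β T f hf).psdm_isHermitian ω).eigenvectorBasis).orthonormal.1 i
      rw [hv, ← EuclideanSpace.norm_sq_eq, this, one_pow]
    have hψ : (matchingSystem S₀ β T f hf).noisePsd ω = σ ω := (hS.2 ω hω).2.1
    have hΦ : (matchingSystem S₀ β T f hf).psdm ω =
        (1 + matchingMatrix β T f).map Complex.ofReal * ((σ ω : ℂ) • 1) *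
          ((1 + matchingMatrix β T f).map Complex.ofReal).conjTranspose := by
      rw [LDS.psdm, inverse_matchingSystem, hψ]
    have heig : ((matchingSystem S₀ β T f hf).psdm_isHermitian ω).eigenvalues i = σ ω *
        ∑ k, ‖((1 + matchingMatrix β T f).map Complex.ofReal).conjTranspose.mulVec v k‖ ^ 2 := by
      rw [← re_quadraticForm_mul_conjTranspose, ← hΦ]
      exact Matrix.IsHermitian.eigenvalues_eq _ i
    have hs2' : s ^ 2 = 1 + |β| * s := by rwa [abs_of_pos hβ]
    have h1 := sum_sq_one_add_matchingMatrix_le hf hinj hs hs2' v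
    -- The inverse is the matching matrix of gain `-β`, so the upper norm bound for it is the lower
    -- bound for the original.
    have h2 := sum_sq_one_add_matchingMatrix_le (b := -β) hf hinj hs (by rwa [abs_neg])
      (((1 + matchingMatrix β T f).map Complex.ofReal).conjTranspose.mulVec v)
    have hinv : ((1 + matchingMatrix (-β) T f).map Complex.ofReal).conjTranspose *
        ((1 + matchingMatrix β T f).map Complex.ofReal).conjTranspose = 1 := by
      rw [← Matrix.conjTranspose_mul, matchingMatrix_neg, ← sub_eq_add_neg]
      have h := congrArg (fun A : Matrix (Fin p) (Fin p) ℝ => A.map Complex.ofRealHom)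
        (mul_eq_one_comm.1 (one_sub_mul_one_add_matchingMatrix (b := β) hf))
      simp only [Matrix.map_mul] at h
      rw [Matrix.map_one _ (map_zero _) (map_one _)] at h
      exact (congrArg Matrix.conjTranspose h).trans Matrix.conjTranspose_one
    rw [Matrix.mulVec_mulVec, hinv, Matrix.one_mulVec, hnorm] at h2
    rw [hnorm, mul_one] at h1
    rw [heig]
    set Q := ∑ k, ‖((1 + matchingMatrix β T f).map Complex.ofReal).conjTranspose.mulVec v k‖ ^ 2
    have hQ : 0 ≤ Q := Finset.sum_nonneg fun k _ => sq_nonneg _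
    constructor
    · rw [inv_le_iff_one_le_mul₀' (by linarith)]
      nlinarith
    · nlinarith

end MatchingSystem

/-! ### Counting and the Fano-type argument -/

lemma div_pow_le_choose {p q : ℕ} (hq : 1 ≤ q) (hqp : q ≤ p) :
    ((p : ℝ) / q) ^ q ≤ p.choose q := by
  have h1 : p ^ q * q.factorial ≤ q ^ q * p.descFactorial q := by
    rw [← Nat.descFactorial_self, Nat.descFactorial_eq_prod_range, Nat.descFactorial_eq_prod_range]
    conv_lhs => rw [← Finset.card_range q, ← Finset.prod_const, Finset.card_range,
      ← Finset.prod_mul_distrib]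
    conv_rhs => enter [1]; rw [← Finset.card_range q, ← Finset.prod_const, Finset.card_range]
    rw [← Finset.prod_mul_distrib]
    -- Factor by factor, `p (q - i) ≤ q (p - i)`, since `q ≤ p`.
    refine Finset.prod_le_prod' fun i hi => ?_
    rw [Nat.mul_sub, Nat.mul_sub, mul_comm p q]
    exact Nat.sub_le_sub_left (Nat.mul_le_mul_right i hqp) _
  rw [Nat.descFactorial_eq_factorial_mul_choose] at h1
  have h2 : p ^ q ≤ q ^ q * p.choose q :=
    Nat.le_of_mul_le_mul_right (h1.trans_eq (by ring)) q.factorial_pos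
  rw [div_pow, div_le_iff₀' (by positivity)]
  exact_mod_cast h2

/-- If `K ≥ 2` alternatives, at divergence at most `D ≤ (1 - 2δ) log K` from a null hypothesis, are
accepted with probabilities `a x` when true and `b x` under the null hypothesis, then the
probabilities of error are not all less than `δ`. -/
lemma not_all_errors_lt {α : Type*} (s : Finset α) (hs : 2 ≤ s.card) {D δ : ℝ} (hδ : 0 < δ)
    (hD : D ≤ (1 - 2 * δ) * Real.log s.card) {a b : α → ℝ}
    (hab : ∀ x ∈ s, ∀ t c : ℝ, 0 < c →
      t * a x ≤ D + Real.log c - 1 + (1 + (Real.exp t - 1) * b x) / c)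
    (ha : ∀ x ∈ s, 1 - δ < a x) (hb : ∑ x ∈ s, b x ≤ δ) : False := by
  set K : ℝ := (s.card : ℝ) with hK
  have hK2 : 2 ≤ K := by rw [hK]; exact_mod_cast hs
  have hlog : 0 < Real.log K := Real.log_pos (by linarith)
  -- With `t = log K`, `c` bounds the average of `1 + (K - 1) * b x`, so after averaging the last
  -- term is at most `1` and cancels the `-1`.
  set c : ℝ := 1 + (K - 1) * δ / K with hc
  have hcpos : 0 < c := by
    have : 0 ≤ (K - 1) * δ / K := div_nonneg (mul_nonneg (by linarith) hδ.le) (by linarith)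
    linarith
  have hsum := Finset.sum_le_sum fun x hx => hab x hx (Real.log K) c hcpos
  rw [Finset.sum_add_distrib, Finset.sum_const, nsmul_eq_mul, ← hK, ← Finset.sum_div,
    Finset.sum_add_distrib, Finset.sum_const, nsmul_eq_mul, ← hK, ← Finset.mul_sum,
    ← Finset.mul_sum, Real.exp_log (by linarith), mul_one] at hsum
  have hKc : (K + (K - 1) * ∑ x ∈ s, b x) / c ≤ K := by
    rw [div_le_iff₀ hcpos]
    have : K * c = K + (K - 1) * δ := by rw [hc]; field_simp
    rw [this]
    nlinarith
  have hlt : K * (Real.log K * (1 - δ)) < ∑ x ∈ s, Real.log K * a x := by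
    rw [hK, ← nsmul_eq_mul, ← Finset.sum_const]
    refine Finset.sum_lt_sum_of_nonempty (Finset.card_pos.1 (by omega)) fun x hx => ?_
    exact mul_lt_mul_of_pos_left (ha x hx) hlog
  rw [← Finset.mul_sum] at hlt
  have h1 : Real.log K * (1 - δ) < D + Real.log c := by
    have : K * (Real.log K * (1 - δ)) < K * (D + Real.log c) := by nlinarith
    exact lt_of_mul_lt_mul_left this (by linarith)
  -- The second `δ` of `1 - 2δ`, bounded by `δ * log K` in the next step; the first came from the
  -- acceptance probabilities `a x`.
  have h2 : Real.log c ≤ δ * (1 - K⁻¹) := by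
    refine (Real.log_le_sub_one_of_pos hcpos).trans (le_of_eq ?_)
    rw [hc]; field_simp; ring
  have h3 : δ * (1 - K⁻¹) ≤ δ * Real.log K :=
    mul_le_mul_of_nonneg_left (Real.one_sub_inv_le_log_of_pos (by linarith)) hδ.le
  nlinarith

lemma exists_matching {p m : ℕ} (hm : 2 * m ≤ p) (T : Finset (Fin p)) (hT : T.card ≤ m) :
    ∃ f : Fin p → Fin p, (∀ i ∈ T, f i ∉ T) ∧ Set.InjOn f T := by
  have hcard : Fintype.card T ≤ Fintype.card (Tᶜ : Finset (Fin p)) := by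
    rw [Fintype.card_coe, Fintype.card_coe, Finset.card_compl, Fintype.card_fin]
    omega
  obtain ⟨e⟩ := Function.Embedding.nonempty_of_card_le hcard
  refine ⟨fun i => if h : i ∈ T then e ⟨i, h⟩ else i, fun i hi => ?_, fun i hi j hj hij => ?_⟩
  · simp only [dif_pos hi]
    exact Finset.mem_compl.1 (e ⟨i, hi⟩).2
  · simp only [dif_pos (Finset.mem_coe.1 hi), dif_pos (Finset.mem_coe.1 hj)] at hij
    exact congrArg Subtype.val (e.injective (Subtype.ext hij))

/-- The error lower bound from the ensemble of matchings with `m` edges, compared with the empty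
graph. -/
lemma exists_error_ge_of_matchings {p q n m : ℕ} {β M δ : ℝ} {σ : ℝ → ℝ} (hq : 1 ≤ q)
    (hm : 1 ≤ m) (hmp : 2 * m ≤ p) (hβ : 0 < β) (hM : 1 < M) {S₀ : LDS p}
    (hS₀ : S₀ ∈ family p q β σ M) (hne : ∃ i j, S₀.graph.Adj j i)
    (hn : n * (m * β ^ 2) ≤ (1 - 2 * δ) * Real.log (p.choose m)) (ω : ℝ) (s : Sampling)
    {Ghat : (Fin n → Fin p → ℂ) → Digraph (Fin p)} (hGhat : IsEstimator Ghat) :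
    ∃ S ∈ family p q β σ M, δ ≤ (S.sampleLaw n ω s).real {y | S.graph ≠ Ghat y} := by
  classical
  by_contra! hcon
  have hnonempty : Nonempty (Fin p → Fin p) := ⟨id⟩
  choose! f hf hinj using exists_matching hmp
  obtain ⟨C, hC⟩ := exists_sampleLaw_eq_mixedLaw S₀ n ω s
  let S : Finset (Fin p) → LDS p := fun T =>
    if hT : T.card ≤ m then matchingSystem S₀ β T (f T) (hf T hT) else S₀
  have hSdef : ∀ T (hT : T.card ≤ m), S T = matchingSystem S₀ β T (f T) (hf T hT) :=
    fun T hT => dif_pos hT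
  have hlaw : ∀ T, T.card ≤ m → (S T).sampleLaw n ω s =
      mixedLaw C (1 + matchingMatrix β T (f T)) := fun T hT => by
    rw [hSdef T hT]
    exact hC _ _ rfl inverse_matchingSystem
  have hmem : ∀ T, T.card ≤ m → S T ∈ family p q β σ M := fun T hT => by
    rw [hSdef T hT]
    exact matchingSystem_mem_family hq hβ hM hS₀ hne (hinj T hT)
  -- `T` is read off the graph as the set of nodes with a parent, so one matching per `T` suffices,
  -- whichever sources it uses.
  have hgraph : ∀ T, T.card ≤ m → ∀ i, i ∈ T ↔ ∃ j, (S T).graph.Adj j i := fun T hT i => by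
    rw [hSdef T hT]
    simp [matchingSystem_adj hβ]
  have hginj : ∀ T T', T.card ≤ m → T'.card ≤ m → (S T).graph = (S T').graph → T = T' := by
    intro T T' hT hT' h
    ext i
    rw [hgraph T hT, hgraph T' hT', h]
  let E : Finset (Fin p) → Set (Fin n → Fin p → ℂ) := fun T => Ghat ⁻¹' {(S T).graph}
  have hE : ∀ T, MeasurableSet (E T) := fun T => hGhat _
  have herr : ∀ T, T.card ≤ m →
      (mixedLaw C (1 + matchingMatrix β T (f T))).real (E T)ᶜ < δ := fun T hT => by
    have h := hcon (S T) (hmem T hT)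
    rw [hlaw T hT] at h
    have heq : {y | (S T).graph ≠ Ghat y} = (E T)ᶜ := by
      ext y
      simp [E, eq_comm]
    rwa [heq] at h
  -- The empty `T` is the null hypothesis; its error bound also forces `δ > 0`.
  have h0 : (1 + matchingMatrix β ∅ (f ∅) : Matrix (Fin p) (Fin p) ℝ) = 1 := by
    ext i j
    simp [matchingMatrix_apply]
  have herr0 := herr ∅ (by simp)
  rw [h0] at herr0
  have hprob : ∀ A : Matrix (Fin p) (Fin p) ℝ, IsProbabilityMeasure (mixedLaw C A) := fun A => by
    unfold mixedLaw; infer_instance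
  have hmem' : ∀ T ∈ Finset.powersetCard m (Finset.univ : Finset (Fin p)), T.card = m :=
    fun T hT => (Finset.mem_powersetCard.1 hT).2
  have hcard : (Finset.powersetCard m (Finset.univ : Finset (Fin p))).card = p.choose m := by
    rw [Finset.card_powersetCard, Finset.card_univ, Fintype.card_fin]
  have hK : 2 ≤ p.choose m := by
    have h1 := Nat.choose_pos (show m ≤ p by omega)
    have h2 : p.choose m ≠ 1 := fun h => by
      rw [Nat.choose_eq_one_iff] at h
      omega
    omega
  refine not_all_errors_lt (Finset.powersetCard m (Finset.univ : Finset (Fin p)))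
    (D := n * (m * β ^ 2)) (δ := δ) (by rwa [hcard])
    (measureReal_nonneg.trans_lt herr0) (by rwa [hcard])
    (a := fun T => (mixedLaw C (1 + matchingMatrix β T (f T))).real (E T))
    (b := fun T => (mixedLaw C (1 : Matrix (Fin p) (Fin p) ℝ)).real (E T)) ?_ ?_ ?_
  · intro T hT t c hc
    have hTm := hmem' T hT
    have h := mul_mixedLaw_le C (abs_det_one_add_matchingMatrix (b := β) (hf T hTm.le)) (hE T) t hc
    -- The `2n` generators cancel the factor `1 / 2` of the divergence.
    rw [sum_sq_one_add_matchingMatrix (hf T hTm.le), hTm] at h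
    refine h.trans (le_of_eq ?_)
    simp
    ring
  · intro T hT
    have h := herr T (hmem' T hT).le
    rw [probReal_compl_eq_one_sub (hE T)] at h
    linarith
  -- Declaring one of the alternatives is an error under the null hypothesis, and the declarations
  -- are disjoint events.
  · have hdisj : Set.PairwiseDisjoint
        (↑(Finset.powersetCard m (Finset.univ : Finset (Fin p)))) E := by
      intro T hT T' hT' hne'
      refine Set.disjoint_left.2 fun y hy hy' => hne' ?_
      exact hginj T T' (hmem' T hT).le (hmem' T' hT').le (hy.symm.trans hy')
    rw [← measureReal_biUnion_finset hdisj fun T _ => hE T]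
    refine le_trans (measureReal_mono ?_) herr0.le
    refine Set.iUnion₂_subset fun T hT y hy hy0 => ?_
    have hTe := hginj T ∅ (hmem' T hT).le (by simp) (hy.symm.trans hy0)
    have := hmem' T hT
    rw [hTe, Finset.card_empty] at this
    omega

end DDAG

end

/-! ### The two terms of the maximum -/

theorem theorem5p1 (p q n : ℕ) (β M δ : ℝ) (σ : ℝ → ℝ)
    (hq : 1 ≤ q) (hpq : (q : ℝ) ≤ (p : ℝ) / 2) (hβ : 0 < β) (hM : 1 < M)
    -- the parameter `q` is attained: some system of the family has a node with `q` parents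
    (hattained : ∃ S ∈ DDAG.family p q β σ M, ∃ i, (DDAG.parents S.graph i).ncard = q)
    (hn : (n : ℝ) ≤ (1 - 2 * δ) *
      max (Real.log p / (2 * β ^ 2 + β ^ 4)) (q * Real.log (p / q) / (M ^ 2 - 1)))
    (ω : ℝ) (hω : ω ∈ Set.Icc 0 (2 * Real.pi)) (s : DDAG.Sampling)
    (Ghat : (Fin n → Fin p → ℂ) → Digraph (Fin p)) (hGhat : DDAG.IsEstimator Ghat) :
    ∃ S ∈ DDAG.family p q β σ M,
      δ ≤ (S.sampleLaw n ω s).real {y | S.graph ≠ Ghat y} := by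
  obtain ⟨S₀, hS₀, i, hi⟩ := hattained
  have hpq' : 2 * q ≤ p := by
    have : (2 * q : ℝ) ≤ p := by linarith
    exact_mod_cast this
  have hne : ∃ i j, S₀.graph.Adj j i := by
    obtain ⟨j, hj⟩ := Set.nonempty_of_ncard_ne_zero (s := DDAG.parents S₀.graph i) (by omega)
    exact ⟨i, j, hj⟩
  rcases max_choice (Real.log p / (2 * β ^ 2 + β ^ 4)) (q * Real.log (p / q) / (M ^ 2 - 1))
    with h | h
  · rw [h, ← mul_div_assoc, le_div_iff₀ (by positivity)] at hn
    refine DDAG.exists_error_ge_of_matchings hq le_rfl (by omega) hβ hM hS₀ hne ?_ ω s hGhat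
    rw [Nat.choose_one_right]
    refine le_trans (mul_le_mul_of_nonneg_left ?_ n.cast_nonneg) hn
    -- Single-edge systems need only `n * β ^ 2`; this is the surplus of the stated denominator.
    have : 0 < β ^ 2 + β ^ 4 := by positivity
    push_cast
    linarith
  · have hM2 : 0 < M ^ 2 - 1 := by nlinarith
    rw [h, ← mul_div_assoc, le_div_iff₀ hM2] at hn
    refine DDAG.exists_error_ge_of_matchings hq hq hpq' hβ hM hS₀ hne ?_ ω s hGhat
    have hq0 : (0 : ℝ) < q := by exact_mod_cast hq
    have hratio : 1 < (p : ℝ) / q := by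
      rw [lt_div_iff₀ hq0]
      linarith
    have hlog : 0 < q * Real.log (p / q) := mul_pos hq0 (Real.log_pos hratio)
    -- The sign comes from `hn` itself, as `n ≥ 0`; it is needed to replace `q * log (p / q)` by the
    -- larger `log (p.choose q)`.
    have hδ : 0 ≤ 1 - 2 * δ := by
      refine nonneg_of_mul_nonneg_left (b := q * Real.log (p / q)) (le_trans ?_ hn) hlog
      positivity
    have hchoose : q * Real.log (p / q) ≤ Real.log (p.choose q) := by
      rw [← Real.log_pow]
      exact Real.log_le_log (by positivity) (DDAG.div_pow_le_choose hq (by omega))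
    obtain ⟨t, ht, ht2⟩ := DDAG.exists_shear_singularValue hβ
    have hσM : σ ω ≤ M := by
      have h1 := (DDAG.family_edge_bounds hβ hM hS₀ hne ht ht2 hω).1
      have h2 := (DDAG.family_inverse hM hS₀ hω i).1
      nlinarith [mul_pos hβ ht]
    have hqβ : q * β ^ 2 ≤ M ^ 2 - 1 := by
      have h1 := DDAG.family_parents_bound hβ hM hS₀ hi hω
      nlinarith
    calc (n : ℝ) * (q * β ^ 2) ≤ n * (M ^ 2 - 1) := mul_le_mul_of_nonneg_left hqβ n.cast_nonneg
      _ ≤ (1 - 2 * δ) * (q * Real.log (p / q)) := hn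
      _ ≤ _ := mul_le_mul_of_nonneg_left hchoose hδ
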